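/- **Proposition 8.** Let $N\ge 3$, $0<q<1$, $n=\lfloor N/2\rfloor$, and $h=0$ if $N$ is odd, $h=1$ if $N$ is even. Let $u_q(e^N)$ be the q-deformed Euclidean $*$-algebra, generated by the Chevalley generators $\mathbf L$ and the Cartan generators $(\mathbf k^i)^{\pm1}$ of $U_{q^{-1}}(so(N))$, the momenta $p^i$ ($|i|\le n$, with $i\ne0$ for even $N$) spanning a quantum Euclidean space, and the dilatations $\Lambda^{\pm1}$ with $\Lambda p^i=q^{-1}p^i\Lambda$, with $(p^i)^*=q^{\rho_i}p^{-i}$ and $\Lambda^*=q^{-N}\Lambda^{-1}$. Here $\rho_i=\tfrac12-i$ ($N$ odd) or $1-i$ ($N$ even) for $i>0$, $\rho_{-i}=-\rho_i$, $\rho_0=0$. Put $(p\cdot p)_l=\sum_{j=1}^l q^{\rho_j}p^{-j}p^j$, plus $(p^0)^2/(1+q^{-1})$ when $N$ is odd. Let $\mathcal H$ be a complex Hilbert space carrying an irreducible $*$-representation of $u_q(e^N)$ by (possibly unbounded) operators on a common invariant dense domain $\mathcal D\subset\mathcal H$ (irreducible: every nonzero invariant subspace of $\mathcal D$ is dense in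 $\mathcal H$). Let $M>0$ and suppose that $\mathcal D$ contains a nonzero joint eigenvector of all $(p\cdot p)_l$, $h\le l\le n$, with $(p\cdot p)_n=M^2$. Set $$\mathcal D_{\vec 0}=\{v\in\mathcal D:\ (p\cdot p)_nv=M^2q^2v,\ p^{-l}v=0\ \text{for } h<l\le n\},$$ and, for $\vec\pi=(\pi_h,\dots,\pi_{n-1},\pi_n)\in\mathbf N^{n-h}\times\mathbf Z$ with $\mathbf N=\{0,1,2,\dots\}$, $$\mathcal D_{\vec\pi}=\Lambda^{\pi_n}(p^n)^{\pi_{n-1}}\cdots(p^{h+1})^{\pi_h}\mathcal D_{\vec 0},\qquad \mathcal H_{\vec\pi}=\overline{\mathcal D_{\vec\pi}}.$$ Then all $\mathcal D_{\vec\pi}$ are nonzero, and $\mathcal H$ is the orthogonal (Hilbert) direct sum $$\mathcal H=\bigoplus_{\vec\pi\in\mathbf N^{n-h}\times\mathbf Z}\mathcal H_{\vec\pi}.$$ For every $\vec\pi$, $\mathcal D_{\vec\pi}$ is exactly the joint eigenspace in $\mathcal D$ of the $(p\cdot p)_l$, and $\mathcal H_{\vec\pi}$ is exactly the joint eigenspace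 of their closures, with $$(p\cdot p)_l=M^2q^{\sum_{k=l}^n2(1+\pi_k)},\qquad l=h,h+1,\dots,n.$$ In particular, the set of eigenvalues of the closure of each $(p\cdot p)_l$ is the q-lattice $\{M^2q^{2r}: r\in\mathbf Z\}$. -/

import Mathlib

open scoped InnerProductSpace

noncomputable section

namespace QEuclid

/-! ### Index conventions for the `N`-dimensional quantum Euclidean space -/

/-- `n = ⌊N/2⌋`, so that `N = 2n + 1` or `N = 2n`. -/
def rk (N : ℕ) : ℕ := N / 2

/-- `h = 0` for odd `N`, `h = 1` for even `N`. -/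
def par (N : ℕ) : ℕ := if Even N then 1 else 0

/-- Space indices: `-n, …, n`, where `0` is left out when `N` is even. -/
def IsIdx (N : ℕ) (i : ℤ) : Prop := |i| ≤ (rk N : ℤ) ∧ (Even N → i ≠ 0)

/-- `ρ_i = 1/2 - i` (`N` odd) or `1 - i` (`N` even) for `i > 0`; `ρ_{-i} = -ρ_i`, `ρ_0 = 0`. -/
def rho (N : ℕ) (i : ℤ) : ℝ :=
  (Int.sign i : ℝ) * ((if Even N then (1 : ℝ) else 1 / 2) - ((|i| : ℤ) : ℝ))

/-- Real powers of the real number `q`, as complex scalars. -/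
def qp (q x : ℝ) : ℂ := ((q ^ x : ℝ) : ℂ)

/-- `(a, m)` labels the simple root `e_m - e_a`, with `e_{-i} = -e_i` and `e_0 = 0`.
The simple roots are `(m - 1, m)` with `h + 1 ≤ m ≤ n` and, for even `N`, also `(-1, 2)`. -/
def IsSimple (N : ℕ) (a m : ℤ) : Prop :=
  (a = m - 1 ∧ (par N : ℤ) + 1 ≤ m ∧ m ≤ (rk N : ℤ)) ∨
    (Even N ∧ a = -1 ∧ m = 2 ∧ 2 ≤ rk N)

/-- Kronecker delta. -/
def kd (i j : ℤ) : ℝ := if i = j then 1 else 0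

/-! ### The q-deformed Euclidean algebra -/

/-- Symbols for the generators. The labels run over all integers; those which do not label a
generator of the `N`-dimensional algebra are trivialized by `Rel.p_triv`, `Rel.k_triv`,
`Rel.raise_triv`, `Rel.lower_triv`.
* `p i` is the momentum component `p^i`;
* `k i` is the Cartan generator `k^i`, with `k^{-i} = (k^i)⁻¹` and `k^0 = 1`;
* `raise a m` is the positive simple root vector `L^{-a,m}`;
* `lower a m` is the negative simple root vector `L^{-m,a}`;
* `lam`, `lamInv` are the dilatation `Λ` and its inverse. -/
inductive Gen : Type
  | p (i : ℤ)
  | k (i : ℤ)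
  | raise (a m : ℤ)
  | lower (a m : ℤ)
  | lam
  | lamInv

/-- The free algebra on the generators. -/
abbrev Free : Type := FreeAlgebra ℂ Gen

namespace Free

def p (i : ℤ) : Free := FreeAlgebra.ι ℂ (Gen.p i)
def k (i : ℤ) : Free := FreeAlgebra.ι ℂ (Gen.k i)
def raise (a m : ℤ) : Free := FreeAlgebra.ι ℂ (Gen.raise a m)
def lower (a m : ℤ) : Free := FreeAlgebra.ι ℂ (Gen.lower a m)
def lam : Free := FreeAlgebra.ι ℂ Gen.lam
def lamInv : Free := FreeAlgebra.ι ℂ Gen.lamInv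

/-- Lowered components `p_i = C_{ij} p^j = q^{-ρ_i} p^{-i}`. -/
def pLow (q : ℝ) (N : ℕ) (i : ℤ) : Free := qp q (-rho N i) • p (-i)

/-- `(p·p)_j = ∑_{l=1}^j p^{-l} p_{-l}`, plus `p^0 p_0 / (1 + q⁻¹)` when `N` is odd. -/
def sqMom (q : ℝ) (N : ℕ) (j : ℕ) : Free :=
  (∑ l ∈ Finset.Icc (1 : ℤ) j, p (-l) * pLow q N (-l)) +
    if Even N then 0 else ((1 + q⁻¹ : ℝ) : ℂ)⁻¹ • (p 0 * pLow q N 0)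

end Free

/-- The deformed commutator `[x, y]_a = x y - a y x`. -/
def qComm {A : Type*} [Ring A] [Algebra ℂ A] (a : ℂ) (x y : A) : A := x * y - a • (y * x)

open Free in
/-- The defining relations of the q-deformed Euclidean algebra. -/
inductive Rel (q : ℝ) (N : ℕ) : Free → Free → Prop
  -- labels out of range
  | p_triv (i : ℤ) (hi : ¬ IsIdx N i) : Rel q N (p i) 0
  | k_triv (i : ℤ) (hi : i = 0 ∨ (rk N : ℤ) < |i|) : Rel q N (k i) 1
  | raise_triv (a m : ℤ) (hr : ¬ IsSimple N a m) : Rel q N (raise a m) 0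
  | lower_triv (a m : ℤ) (hr : ¬ IsSimple N a m) : Rel q N (lower a m) 0
  -- Cartan generators
  | k_inv (i : ℤ) : Rel q N (k i * k (-i)) 1
  | k_comm (i j : ℤ) : Rel q N (qComm 1 (k i) (k j)) 0
  | k_raise (i a m : ℤ) (hi : 1 ≤ i) (hr : IsSimple N a m) :
      Rel q N (qComm (qp q (2 * (kd i m - kd i a + kd i (-a)))) (k i) (raise a m)) 0
  | k_lower (i a m : ℤ) (hi : 1 ≤ i) (hr : IsSimple N a m) :
      Rel q N (qComm (qp q (-(2 * (kd i m - kd i a + kd i (-a))))) (k i) (lower a m)) 0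
  -- positive with negative simple roots
  | raise_lower (a m b l : ℤ) (hr : IsSimple N a m) (hs : IsSimple N b l)
      (hne : (a, m) ≠ (b, l)) :
      Rel q N (qComm (if |m - l| = 1 then qp q (-1) else 1) (raise a m) (lower b l)) 0
  | raise_lower_same (a m : ℤ) (hr : IsSimple N a m) (hm : 2 ≤ m) :
      Rel q N (qComm (qp q 2) (raise a m) (lower a m))
        ((qp q (1 + 2 * rho N m) / ((q - q⁻¹ : ℝ) : ℂ)) • (1 - k a * k (-m)))
  | raise_lower_short (hr : IsSimple N 0 1) :
      Rel q N (qComm (qp q 1) (raise 0 1) (lower 0 1))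
        ((qp q (-(1 / 2)) / ((q - q⁻¹ : ℝ) : ℂ)) • (1 - k (-1)))
  -- Serre relations, non-adjacent simple roots
  | serre_raise_comm (a m b l : ℤ) (hr : IsSimple N a m) (hs : IsSimple N b l)
      (hml : |m - l| ≠ 1) : Rel q N (qComm 1 (raise a m) (raise b l)) 0
  | serre_lower_comm (a m b l : ℤ) (hr : IsSimple N a m) (hs : IsSimple N b l)
      (hml : |m - l| ≠ 1) : Rel q N (qComm 1 (lower a m) (lower b l)) 0
  -- Serre relations, adjacent simple roots
  | serre_raise_right (a m : ℤ) (hr : IsSimple N a m) (hs : IsSimple N m (m + 1)) :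
      Rel q N (qComm (qp q 1) (raise m (m + 1))
        (qComm (qp q 1) (raise a m) (raise m (m + 1)))) 0
  | serre_raise_left (a m : ℤ) (hr : IsSimple N a m) (hs : IsSimple N m (m + 1)) (hm : 2 ≤ m) :
      Rel q N (qComm (qp q (-1)) (raise a m)
        (qComm (qp q 1) (raise a m) (raise m (m + 1)))) 0
  | serre_lower_right (a m : ℤ) (hr : IsSimple N a m) (hs : IsSimple N m (m + 1)) :
      Rel q N (qComm (qp q 1) (qComm (qp q 1) (lower m (m + 1)) (lower a m))
        (lower m (m + 1))) 0
  | serre_lower_left (a m : ℤ) (hr : IsSimple N a m) (hs : IsSimple N m (m + 1)) (hm : 2 ≤ m) :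
      Rel q N (qComm (qp q (-1)) (qComm (qp q 1) (lower m (m + 1)) (lower a m))
        (lower a m)) 0
  -- Serre relations at the short root, `N` odd
  | serre_raise_short (hr : IsSimple N 0 1) (hs : IsSimple N 1 2) :
      Rel q N (qComm (qp q (-1)) (raise 0 1)
        (qComm 1 (qComm (qp q 1) (raise 0 1) (raise 1 2)) (raise 0 1))) 0
  | serre_lower_short (hr : IsSimple N 0 1) (hs : IsSimple N 1 2) :
      Rel q N (qComm (qp q (-1))
        (qComm 1 (lower 0 1) (qComm (qp q 1) (lower 1 2) (lower 0 1))) (lower 0 1)) 0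
  -- the momenta generate a quantum Euclidean space
  | p_comm (i j : ℤ) (hi : IsIdx N i) (hj : IsIdx N j) (hij : i < j) (hne : j ≠ -i) :
      Rel q N (qComm (qp q 1) (p i) (p j)) 0
  | p_square (j : ℕ) (hj : 1 ≤ j) (hjn : j ≤ rk N) :
      Rel q N (∑ l ∈ Finset.Icc (-(j : ℤ)) j, p l * pLow q N l)
        ((1 + qp q (-(2 * rho N j))) • sqMom q N j)
  -- Cartan generators with momenta
  | k_p (i j : ℤ) (hi : 1 ≤ i) (hj : IsIdx N j) :
      Rel q N (qComm (qp q (2 * (kd j i - kd j (-i)))) (k i) (p j)) 0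
  -- simple roots with momenta
  | raise_p_top (a m : ℤ) (hr : IsSimple N a m) (ha : a ≠ 0) :
      Rel q N (qComm (qp q 1) (raise a m) (p a)) (-(qp q (rho N m) • p m))
  | raise_p_bot (a m : ℤ) (hr : IsSimple N a m) :
      Rel q N (qComm (qp q 1) (raise a m) (p (-m))) (qp q (rho N m) • p (-a))
  | raise_p_zero (hr : IsSimple N 0 1) :
      Rel q N (qComm 1 (raise 0 1) (p 0)) (-(qp q (-1) • p 1))
  | raise_p_other (a m i : ℤ) (hr : IsSimple N a m) (hi : IsIdx N i) (hia : i ≠ a)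
      (him : i ≠ -m) :
      Rel q N (qComm (qp q ((kd i a - kd i (-a)) - (kd i m - kd i (-m)))) (raise a m) (p i)) 0
  | lower_p_top (a m : ℤ) (hr : IsSimple N a m) :
      Rel q N (qComm (qp q (-1)) (lower a m) (p m)) (-(qp q (rho N m) • p a))
  | lower_p_bot (a m : ℤ) (hr : IsSimple N a m) (ha : a ≠ 0) :
      Rel q N (qComm (qp q (-1)) (lower a m) (p (-a))) (qp q (rho N m) • p (-m))
  | lower_p_zero (hr : IsSimple N 0 1) :
      Rel q N (qComm 1 (lower 0 1) (p 0)) (p (-1))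
  | lower_p_other (a m i : ℤ) (hr : IsSimple N a m) (hi : IsIdx N i) (him : i ≠ m)
      (hia : i ≠ -a) :
      Rel q N (qComm (qp q ((kd i a - kd i (-a)) - (kd i m - kd i (-m)))) (lower a m) (p i)) 0
  -- dilatations
  | lam_lamInv : Rel q N (lam * lamInv) 1
  | lamInv_lam : Rel q N (lamInv * lam) 1
  | lam_p (i : ℤ) : Rel q N (qComm (qp q (-1)) lam (p i)) 0
  | lam_k (i : ℤ) : Rel q N (qComm 1 lam (k i)) 0
  | lam_raise (a m : ℤ) : Rel q N (qComm 1 lam (raise a m)) 0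
  | lam_lower (a m : ℤ) : Rel q N (qComm 1 lam (lower a m)) 0

/-- The q-deformed Euclidean algebra `u_q(e^N)`: generators and relations over `ℂ`. -/
abbrev Alg (q : ℝ) (N : ℕ) : Type := RingQuot (Rel q N)

/-- The quotient map from the free algebra. -/
def toAlg (q : ℝ) (N : ℕ) : Free →ₐ[ℂ] Alg q N := RingQuot.mkAlgHom ℂ (Rel q N)

/-- The generators as elements of the algebra. -/
def gen (q : ℝ) (N : ℕ) (g : Gen) : Alg q N := toAlg q N (FreeAlgebra.ι ℂ g)

/-- The squared momentum observable `(p·p)_l` in the algebra. -/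
def sqMom (q : ℝ) (N : ℕ) (l : ℕ) : Alg q N := toAlg q N (Free.sqMom q N l)

/-- The `*`-structure on generators: `(p^i)* = p^j C_{ji} = q^{ρ_i} p^{-i}`, `(k^i)* = k^i`,
`(L^{-a,m})* = q^{-2} L^{-m,a}` for `m ≥ 2`, `(L^{0,1})* = q^{-3/2} L^{-1,0}`,
`Λ* = q^{-N} Λ⁻¹`. It extends to the algebra as an antilinear antihomomorphism. -/
def starGen (q : ℝ) (N : ℕ) : Gen → Alg q N
  | .p i => qp q (rho N i) • gen q N (.p (-i))
  | .k i => gen q N (.k i)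
  | .raise a m => qp q (if m = 1 then -(3 / 2) else -2) • gen q N (.lower a m)
  | .lower a m => qp q (if m = 1 then 3 / 2 else 2) • gen q N (.raise a m)
  | .lam => qp q (-N) • gen q N .lamInv
  | .lamInv => qp q N • gen q N .lam

/-! ### Hilbert space representations -/

/-- A `*`-representation of the q-deformed Euclidean algebra on the Hilbert space `H`, by
possibly unbounded operators with a common invariant dense domain. As `*` is an antilinear
antihomomorphism, `Γ(a)† = Γ(a*)` on the domain for every `a` amounts to `Γ(g)† = Γ(g*)` for
the generators `g`. -/
structure HilbertRep (q : ℝ) (N : ℕ) (H : Type*) [NormedAddCommGroup H]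
    [InnerProductSpace ℂ H] where
  /-- the domain -/
  dom : Submodule ℂ H
  dense_dom : Dense (dom : Set H)
  /-- the action on the domain -/
  act : Alg q N →ₐ[ℂ] Module.End ℂ dom
  act_star : ∀ (g : Gen) (u v : dom),
    ⟪act (gen q N g) u, v⟫_ℂ = ⟪u, act (starGen q N g) v⟫_ℂ

/-- Labels `π = (π_h, …, π_{n-1}; π_n) ∈ ℕ^{n-h} × ℤ`. -/
abbrev Label (N : ℕ) : Type := (Fin (rk N - par N) → ℕ) × ℤ

/-- The component `π_k`, for `h ≤ k ≤ n`. -/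
def Label.comp {N : ℕ} (π : Label N) (k : ℕ) : ℤ :=
  if hk : k - par N < rk N - par N then (π.1 ⟨k - par N, hk⟩ : ℤ) else π.2

/-- `M² q^{∑_{k=l}^n 2 (1 + π_k)}`. -/
def eigenval (q M : ℝ) {N : ℕ} (π : Label N) (l : ℕ) : ℝ :=
  M ^ 2 * q ^ (∑ k ∈ Finset.Icc l (rk N), 2 * (1 + π.comp k))

/-- Integer powers of the dilatation `Λ`. -/
def lamPow (q : ℝ) (N : ℕ) : ℤ → Alg q N
  | .ofNat r => gen q N .lam ^ r
  | .negSucc r => gen q N .lamInv ^ (r + 1)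

/-- `Λ^{π_n} (p^n)^{π_{n-1}} ⋯ (p^{h+1})^{π_h}`. -/
def ladder (q : ℝ) {N : ℕ} (π : Label N) : Alg q N :=
  lamPow q N π.2 *
    (List.ofFn fun j : Fin (rk N - par N) =>
      gen q N (.p ((par N : ℤ) + 1 + (j : ℤ))) ^ π.1 j).reverse.prod

namespace HilbertRep

variable {q : ℝ} {N : ℕ} {H : Type*} [NormedAddCommGroup H] [InnerProductSpace ℂ H]

/-- Irreducibility: every nonzero invariant subspace of the domain is dense in the Hilbert
space. -/
def IsIrreducible (Γ : HilbertRep q N H) : Prop :=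
  Γ.dom ≠ ⊥ ∧ ∀ W : Submodule ℂ Γ.dom, (∀ a, ∀ w ∈ W, Γ.act a w ∈ W) →
    W = ⊥ ∨ Dense (W.map Γ.dom.subtype : Set H)

/-- There is a normalizable joint eigenvector of all the observables `(p·p)_l`, `h ≤ l ≤ n`,
with `(p·p)_n = M²`. -/
def HasEigenstate (Γ : HilbertRep q N H) (M : ℝ) : Prop :=
  ∃ ψ : Γ.dom, ψ ≠ 0 ∧ Γ.act (sqMom q N (rk N)) ψ = ((M ^ 2 : ℝ) : ℂ) • ψ ∧
    ∀ l ∈ Finset.Icc (par N) (rk N), ∃ a : ℂ, Γ.act (sqMom q N l) ψ = a • ψ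

/-- The vectors of the domain with `(p·p)_n = M² q²` which are annihilated by all `p^{-l}`,
`h < l ≤ n`. -/
def ground (Γ : HilbertRep q N H) (M : ℝ) : Submodule ℂ Γ.dom :=
  LinearMap.ker (Γ.act (sqMom q N (rk N)) - ((M ^ 2 * q ^ 2 : ℝ) : ℂ) • 1) ⊓
    ⨅ l ∈ Finset.Ioc (par N) (rk N), LinearMap.ker (Γ.act (gen q N (.p (-(l : ℤ)))))

/-- `Λ^{π_n} (p^n)^{π_{n-1}} ⋯ (p^{h+1})^{π_h}` applied to the ground space, in the domain. -/
def domSector (Γ : HilbertRep q N H) (M : ℝ) (π : Label N) : Submodule ℂ Γ.dom :=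
  (Γ.ground M).map (Γ.act (ladder q π))

/-- The corresponding closed subspace of the Hilbert space. -/
def sector (Γ : HilbertRep q N H) (M : ℝ) (π : Label N) : Submodule ℂ H :=
  ((Γ.domSector M π).map Γ.dom.subtype).topologicalClosure

/-- The closed operator in the Hilbert space given by `(p·p)_l`: the closure of its graph. -/
def observable (Γ : HilbertRep q N H) (l : ℕ) : Submodule ℂ (H × H) :=
  (LinearMap.range
    (Γ.dom.subtype.prod (Γ.dom.subtype ∘ₗ Γ.act (sqMom q N l)))).topologicalClosure

end HilbertRep

end QEuclid

end

namespace QEuclid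

/-! ### Algebra: commutation up to a scalar -/

/-! Write s_l for `(p·p)_l`, n for `rk N` and h for `par N`. The theorem is a ladder argument for
the symmetric operators s_h, …, s_n.

Algebra. The relations give p^{-(l+1)} p^{l+1} ∝ s_{l+1} - s_l and p^{l+1} p^{-(l+1)} ∝ s_{l+1} -
q^{-2} s_l (`mom_neg_mul_mom`, `mom_mul_mom_neg`). Moreover, p^i and Λ commute with each s_l up to a
power of q² (`qcommute_sqMom_mom`, `qcommute_sqMom_lam`), so they carry joint eigenvectors to joint
eigenvectors.

Spectrum. Since (p^i)* ∝ p^{-i}, the second product formula forces s_l ≤ q² s_{l+1} on a joint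
eigenvector, with equality exactly when p^{-(l+1)} kills it. As p^{-(l+1)} multiplies s_l by q^{-2}
and fixes s_{l+1}, iteration must stop, so s_l / s_{l+1} is q^{2(k+1)} for a natural number k
(`joint_ratio`). The eigenvalue s_l = 0 is excluded by means of a simple root vector (`joint_pos`).

Sectors. Where s_l < s_{l+1}, both products above are nonzero scalars, so p^{l+1} is a bijection
between joint eigenspaces; so is Λ. Hence the ladder monomials map the ground space bijectively onto
every joint eigenspace of the lattice (`shifts_ladder`, `domSector_eq`), and one eigenvector makes
all of them nonzero.

Completeness. A simple root vector commutes with all s_j but one, and its commutator with that one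
is a multiple of a product of two momenta; therefore it maps a joint eigenvector to a sum of two
(`act_mem_total_of_commutator`). The sum of the joint eigenspaces is thus invariant, and
irreducibility makes it dense. Symmetry of the s_l yields orthogonality, and density then settles
the claims about closures. -/

theorem qp_add {q : ℝ} (hq : 0 < q) (x y : ℝ) : qp q (x + y) = qp q x * qp q y := by
  simp [qp, Real.rpow_add hq]

theorem qp_zero (q : ℝ) : qp q 0 = 1 := by simp [qp]

theorem qp_one (q : ℝ) : qp q 1 = q := by simp [qp]

theorem qp_neg {q : ℝ} (hq : 0 < q) (x : ℝ) : qp q (-x) = (qp q x)⁻¹ := by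
  simp [qp, Real.rpow_neg hq.le]

theorem qp_ne_zero {q : ℝ} (hq : 0 < q) (x : ℝ) : qp q x ≠ 0 := by
  simp [qp, (Real.rpow_pos_of_pos hq x).ne']

/-- `x` and `y` commute up to the scalar `c`. -/
def QCommute {A : Type*} [Ring A] [Algebra ℂ A] (c : ℂ) (x y : A) : Prop :=
  x * y = c • (y * x)

namespace QCommute

variable {A : Type*} [Ring A] [Algebra ℂ A] {c d : ℂ} {x y z : A}

theorem mul_right (h : QCommute c x y) (h' : QCommute d x z) : QCommute (c * d) x (y * z) := by
  unfold QCommute at *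
  rw [← mul_assoc, h, smul_mul_assoc, mul_assoc, h', mul_smul_comm, smul_smul, mul_assoc]

theorem add_right (h : QCommute c x y) (h' : QCommute c x z) : QCommute c x (y + z) := by
  unfold QCommute at *
  rw [mul_add, h, h', add_mul, smul_add]

theorem smul_right (a : ℂ) (h : QCommute c x y) : QCommute c x (a • y) := by
  unfold QCommute at *
  rw [mul_smul_comm, h, smul_mul_assoc, smul_comm]

theorem smul_left (a : ℂ) (h : QCommute c x y) : QCommute c (a • x) y := by
  unfold QCommute at *
  rw [mul_smul_comm, smul_mul_assoc, h, smul_comm]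

theorem symm (h : QCommute c x y) (hcd : c * d = 1) : QCommute d y x := by
  unfold QCommute at *
  rw [h, smul_smul, mul_comm d, hcd, one_smul]

theorem zero_left (c : ℂ) (x : A) : QCommute c 0 x := by simp [QCommute]

theorem zero_right (c : ℂ) (x : A) : QCommute c x 0 := by simp [QCommute]

theorem one_right (x : A) : QCommute 1 x 1 := by simp [QCommute]

theorem inv_right (h : QCommute 1 x y) (hyz : y * z = 1) (hzy : z * y = 1) :
    QCommute 1 x z := by
  unfold QCommute at *
  rw [one_smul] at *
  calc x * z = z * y * x * z := by rw [hzy, one_mul]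
    _ = z * (y * x) * z := by rw [mul_assoc z]
    _ = z * x := by rw [← h, mul_assoc, mul_assoc, hyz, mul_one]

end QCommute

/-! ### Relations in the q-deformed Euclidean algebra -/

variable {q : ℝ} {N : ℕ}

theorem toAlg_rel {x y : Free} (h : Rel q N x y) : toAlg q N x = toAlg q N y :=
  RingQuot.mkAlgHom_rel ℂ h

theorem qcommute_of_rel {c : ℂ} {x y : Free} (h : Rel q N (qComm c x y) 0) :
    QCommute c (toAlg q N x) (toAlg q N y) := by
  have := toAlg_rel h
  simp only [qComm, map_sub, map_mul, map_smul, map_zero, sub_eq_zero] at this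
  exact this

theorem mul_eq_of_rel {c : ℂ} {x y z : Free} (h : Rel q N (qComm c x y) z) :
    toAlg q N x * toAlg q N y = c • (toAlg q N y * toAlg q N x) + toAlg q N z := by
  have := toAlg_rel h
  rw [← this]
  simp [qComm]

variable (q N) in
/-- The momentum component `p^i` as an element of the algebra. -/
abbrev mom (i : ℤ) : Alg q N := gen q N (.p i)

theorem toAlg_p (i : ℤ) : toAlg q N (Free.p i) = mom q N i := rfl

theorem mom_eq_zero {i : ℤ} (hi : ¬ IsIdx N i) : mom q N i = 0 := by
  exact (toAlg_rel (Rel.p_triv (q := q) i hi)).trans (map_zero _)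

/-- Momenta with labels out of range vanish, so no range hypotheses are needed here or in later
uses. -/
theorem mom_qcommute {i j : ℤ} (hij : i < j) (hne : j ≠ -i) :
    QCommute (q : ℂ) (mom q N i) (mom q N j) := by
  by_cases hi : IsIdx N i
  · by_cases hj : IsIdx N j
    · rw [← qp_one]; exact qcommute_of_rel (Rel.p_comm (q := q) i j hi hj hij hne)
    · rw [mom_eq_zero hj]; exact QCommute.zero_right _ _
  · rw [mom_eq_zero hi]; exact QCommute.zero_left _ _

theorem mom_qcommute' (hq : 0 < q) {i j : ℤ} (hij : i < j) (hne : j ≠ -i) :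
    QCommute (q : ℂ)⁻¹ (mom q N j) (mom q N i) :=
  (mom_qcommute hij hne).symm (mul_inv_cancel₀ (by exact_mod_cast hq.ne'))

/-! ### Recursion for the squared momenta and reordering of opposite momenta -/

theorem rho_zero : rho N 0 = 0 := by simp [rho]

theorem rho_neg (i : ℤ) : rho N (-i) = -rho N i := by
  simp [rho, Int.sign_neg]

theorem rho_succ (l : ℕ) : rho N ((l : ℤ) + 1) = (if Even N then (1 : ℝ) else 1 / 2) - (l + 1) := by
  have h : (0 : ℤ) < (l : ℤ) + 1 := by positivity
  simp [rho, Int.sign_eq_one_of_pos h, abs_of_pos h]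

theorem rho_succ_succ (l : ℕ) : rho N ((l : ℤ) + 1 + 1) = rho N ((l : ℤ) + 1) - 1 := by
  have := rho_succ (N := N) (l + 1)
  push_cast at this
  rw [this, rho_succ]; ring

theorem sqMom_succ (l : ℕ) : sqMom q N (l + 1) = sqMom q N l +
    qp q (rho N ((l : ℤ) + 1)) • (mom q N (-((l : ℤ) + 1)) * mom q N ((l : ℤ) + 1)) := by
  have h : Finset.Icc (1 : ℤ) ((l : ℤ) + 1) = insert ((l : ℤ) + 1) (Finset.Icc (1 : ℤ) l) := by
    ext x; simp; omega
  unfold sqMom Free.sqMom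
  push_cast
  rw [h, Finset.sum_insert (by simp)]
  rw [add_assoc, map_add, add_comm]
  simp only [Free.pLow, map_mul, map_smul, toAlg_p, rho_neg, neg_neg, mul_smul_comm]

theorem sqMom_zero_even (hN : Even N) : sqMom q N 0 = 0 := by
  simp [sqMom, Free.sqMom, hN]

theorem sqMom_zero_odd (hN : ¬ Even N) :
    sqMom q N 0 = ((1 + q⁻¹ : ℝ) : ℂ)⁻¹ • (mom q N 0 * mom q N 0) := by
  simp [sqMom, Free.sqMom, hN, Free.pLow, toAlg_p, rho_zero, qp_zero]

variable (q N) in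
/-- The full sum `∑_{|i| ≤ l} p^i p_i`. -/
noncomputable def fullSq (l : ℕ) : Alg q N :=
  ∑ i ∈ Finset.Icc (-(l : ℤ)) l, qp q (-rho N i) • (mom q N i * mom q N (-i))

theorem fullSq_succ (l : ℕ) : fullSq q N (l + 1) = fullSq q N l +
    qp q (rho N ((l : ℤ) + 1)) • (mom q N (-((l : ℤ) + 1)) * mom q N ((l : ℤ) + 1)) +
    qp q (-rho N ((l : ℤ) + 1)) • (mom q N ((l : ℤ) + 1) * mom q N (-((l : ℤ) + 1))) := by
  have h : Finset.Icc (-((l : ℤ) + 1)) ((l : ℤ) + 1) =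
      insert ((l : ℤ) + 1) (insert (-((l : ℤ) + 1)) (Finset.Icc (-(l : ℤ)) l)) := by
    ext x; simp; omega
  unfold fullSq
  push_cast
  rw [h, Finset.sum_insert (by simp; omega), Finset.sum_insert (by simp)]
  simp only [rho_neg, neg_neg]
  abel

theorem fullSq_eq {l : ℕ} (hl : 1 ≤ l) (hln : l ≤ rk N) :
    fullSq q N l = (1 + qp q (-(2 * rho N l))) • sqMom q N l := by
  have := toAlg_rel (Rel.p_square (q := q) (N := N) l hl hln)
  simpa [Free.pLow, toAlg_p, fullSq, sqMom] using this

theorem mom_zero_even (hN : Even N) : mom q N 0 = 0 :=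
  mom_eq_zero (fun h => h.2 hN rfl)

/-- Expressing the factor through ρ_{l+1} makes it correct also at l = 0 for odd N, where it equals
the normalization 1 + q⁻¹ of `(p·p)_0`. -/
theorem fullSq_eq' (hq : 0 < q) {l : ℕ} (hl : par N ≤ l) (hln : l ≤ rk N) :
    fullSq q N l = (1 + qp q (-(2 * rho N ((l : ℤ) + 1)) - 2)) • sqMom q N l := by
  rcases Nat.eq_zero_or_pos l with rfl | h
  · have hN : ¬ Even N := fun h => by simp [par, h] at hl
    rw [sqMom_zero_odd hN, smul_smul]
    have h2 := rho_succ (N := N) 0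
    rw [if_neg hN] at h2
    rw [h2]
    have : (1 + qp q (-(2 * ((1 : ℝ) / 2 - ((0 : ℕ) + 1))) - 2)) = ((1 + q⁻¹ : ℝ) : ℂ) := by
      norm_num [qp, Real.rpow_neg_one]
    rw [this, mul_inv_cancel₀ (by exact_mod_cast (by positivity : (1 + q⁻¹ : ℝ) ≠ 0))]
    simp [fullSq, rho_zero, qp_zero]
  · rw [fullSq_eq h hln]
    obtain ⟨j, rfl⟩ := Nat.exists_eq_succ_of_ne_zero h.ne'
    push_cast
    rw [rho_succ_succ]
    congr 3
    ring

/-- The full sums at l and l + 1 are multiples of `(p·p)_l` and `(p·p)_{l+1}` and differ by the two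
orderings of p^{±(l+1)}. One ordering is known from `sqMom_succ`; the other is solved for. -/
theorem mom_mul_mom_neg (hq : 0 < q) {l : ℕ} (hl : par N ≤ l) (hln : l + 1 ≤ rk N) :
    mom q N ((l : ℤ) + 1) * mom q N (-((l : ℤ) + 1)) =
      (qp q (rho N ((l : ℤ) + 1)))⁻¹ • (sqMom q N (l + 1) - qp q (-2) • sqMom q N l) := by
  have h1 := fullSq_eq (q := q) (N := N) (l := l + 1) (by omega) hln
  have h0 := fullSq_eq' hq hl (by omega)
  rw [fullSq_succ, h0] at h1
  have hs := sqMom_succ (q := q) (N := N) l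
  set r := rho N ((l : ℤ) + 1)
  have hc := qp_ne_zero hq r
  push_cast at h1
  have hr : rho N ((l : ℤ) + 1) = r := rfl
  rw [hr] at h1
  have e1 : qp q (-(2 * r)) = (qp q r)⁻¹ * (qp q r)⁻¹ := by
    rw [← qp_neg hq, ← qp_add hq]; congr 1; ring
  have e2 : qp q (-(2 * r) - 2) = (qp q r)⁻¹ * (qp q r)⁻¹ * qp q (-2) := by
    rw [← e1, ← qp_add hq]; congr 1
  rw [e1, e2, qp_neg hq r] at h1
  have h2 := congrArg (fun x => qp q r • x) h1
  simp only [smul_add, smul_smul, mul_inv_cancel₀ hc, one_smul] at h2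
  have h3 : mom q N ((l : ℤ) + 1) * mom q N (-((l : ℤ) + 1)) =
      (qp q r * (1 + (qp q r)⁻¹ * (qp q r)⁻¹)) • sqMom q N (l + 1) -
      (qp q r * (1 + (qp q r)⁻¹ * (qp q r)⁻¹ * qp q (-2))) • sqMom q N l -
      qp q r • (sqMom q N (l + 1) - sqMom q N l) := by
    rw [← h2, hs]
    module
  rw [h3]
  match_scalars
  · field_simp; ring
  · field_simp; ring

theorem mom_neg_mul_mom (hq : 0 < q) (l : ℕ) :
    mom q N (-((l : ℤ) + 1)) * mom q N ((l : ℤ) + 1) =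
      (qp q (rho N ((l : ℤ) + 1)))⁻¹ • (sqMom q N (l + 1) - sqMom q N l) := by
  rw [sqMom_succ, add_sub_cancel_left, smul_smul, inv_mul_cancel₀ (qp_ne_zero hq _), one_smul]

/-- For even N, ρ_1 = 0, and the square relation at 1 reads p^{-1} p^1 + p^1 p^{-1} = 2 p^{-1} p^1.
-/
theorem mom_one_comm_even (hN : Even N) (hn : 1 ≤ rk N) :
    mom q N 1 * mom q N (-1) = mom q N (-1) * mom q N 1 := by
  have h1 := fullSq_eq (q := q) (N := N) (l := 1) le_rfl hn
  have h2 := fullSq_succ (q := q) (N := N) 0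
  have h3 := sqMom_succ (q := q) (N := N) 0
  have hr := rho_succ (N := N) 0
  rw [sqMom_zero_even hN] at h3
  have h0 : fullSq q N 0 = 0 := by simp [fullSq, mom_zero_even hN]
  simp [hN] at hr
  simp only [h0, Nat.cast_zero, zero_add, hr, neg_zero, qp_zero, one_smul, Nat.cast_one,
    mul_zero] at h1 h2 h3
  rw [h2, h3, add_smul, one_smul] at h1
  exact add_left_cancel h1

/-! ### Squared momenta against momenta, dilatations and Cartan generators -/

/-- An element which commutes up to `c` with all summands of `(p·p)_l` does so with the sum. -/
theorem QCommute.sqMom {c : ℂ} {x : Alg q N} {l : ℕ}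
    (h : ∀ j : ℕ, j + 1 ≤ l →
      QCommute c x (mom q N (-((j : ℤ) + 1)) * mom q N ((j : ℤ) + 1)))
    (h0 : ¬ Even N → QCommute c x (mom q N 0 * mom q N 0)) :
    QCommute c x (sqMom q N l) := by
  induction l with
  | zero =>
    by_cases hN : Even N
    · rw [sqMom_zero_even hN]; exact .zero_right _ _
    · rw [sqMom_zero_odd hN]; exact (h0 hN).smul_right _
  | succ l ih =>
    rw [sqMom_succ]
    exact (ih fun j hj => h j (by omega)).add_right ((h l le_rfl).smul_right _)

/-- The factor by which `p^i` changes the value of `(p·p)_l`. -/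
noncomputable def weight (q : ℝ) (l : ℕ) (i : ℤ) : ℝ :=
  if (l : ℤ) < i then q ^ 2 else if (l : ℤ) < -i then (q ^ 2)⁻¹ else 1

/-- All indices occurring in `(p·p)_l` lie below i and differ from -i, so each of the two factors of
a summand contributes one power of q. -/
theorem qcommute_sqMom_of_lt (hq : 0 < q) {l : ℕ} {i : ℤ} (hi : (l : ℤ) < i) :
    QCommute ((q : ℂ) ^ 2) (sqMom q N l) (mom q N i) := by
  have hq' : (q : ℂ) ≠ 0 := by exact_mod_cast hq.ne'
  refine QCommute.symm (c := (q : ℂ)⁻¹ * (q : ℂ)⁻¹) (QCommute.sqMom (fun j hj => ?_) fun _ => ?_)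
    (by field_simp)
  · exact (mom_qcommute' hq (by omega) (by omega)).mul_right
      (mom_qcommute' hq (by omega) (by omega))
  · exact (mom_qcommute' hq (by omega) (by omega)).mul_right
      (mom_qcommute' hq (by omega) (by omega))

theorem qcommute_sqMom_of_lt_neg (hq : 0 < q) {l : ℕ} {i : ℤ} (hi : (l : ℤ) < -i) :
    QCommute (((q : ℂ) ^ 2)⁻¹) (sqMom q N l) (mom q N i) := by
  have hq' : (q : ℂ) ≠ 0 := by exact_mod_cast hq.ne'
  refine QCommute.symm (c := (q : ℂ) * (q : ℂ)) (QCommute.sqMom (fun j hj => ?_) fun _ => ?_)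
    (by field_simp)
  · exact (mom_qcommute (by omega) (by omega)).mul_right
      (mom_qcommute (by omega) (by omega))
  · exact (mom_qcommute (by omega) (by omega)).mul_right
      (mom_qcommute (by omega) (by omega))

/-- Associativity of p^{l+1} p^{-(l+1)} p^{l+1}: evaluating both bracketings by the product
formulas, the terms with `(p·p)_l` cancel because its weight q² offsets the factor q^{-2}. The
opposite momentum is treated alike. -/
theorem qcommute_sqMom_succ (hq : 0 < q) {l : ℕ} (hl : par N ≤ l) (hln : l + 1 ≤ rk N) :
    QCommute 1 (sqMom q N (l + 1)) (mom q N ((l : ℤ) + 1)) ∧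
      QCommute 1 (sqMom q N (l + 1)) (mom q N (-((l : ℤ) + 1))) := by
  have hA := mom_neg_mul_mom (q := q) (N := N) hq l
  have hB := mom_mul_mom_neg hq hl hln
  have hc := inv_ne_zero (qp_ne_zero hq (rho N ((l : ℤ) + 1)))
  have h1 := qcommute_sqMom_of_lt (N := N) hq (l := l) (i := (l : ℤ) + 1) (by omega)
  have h2 := qcommute_sqMom_of_lt_neg (N := N) hq (l := l) (i := -((l : ℤ) + 1)) (by omega)
  have hq2 : qp q (-2) = ((q : ℂ) ^ 2)⁻¹ := by
    rw [qp_neg hq]; norm_num [qp]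
  have hq' : (q : ℂ) ≠ 0 := by exact_mod_cast hq.ne'
  rw [hq2] at hB
  unfold QCommute at *
  constructor
  · have h3 := mul_assoc (mom q N ((l : ℤ) + 1)) (mom q N (-((l : ℤ) + 1)))
      (mom q N ((l : ℤ) + 1))
    rw [hA, hB, smul_mul_assoc, mul_smul_comm] at h3
    have h4 := smul_right_injective _ hc h3
    rw [sub_mul, mul_sub, smul_mul_assoc, h1, smul_smul, inv_mul_cancel₀ (by positivity),
      one_smul] at h4
    rw [one_smul]
    exact sub_left_injective h4
  · have h3 := mul_assoc (mom q N (-((l : ℤ) + 1))) (mom q N ((l : ℤ) + 1))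
      (mom q N (-((l : ℤ) + 1)))
    rw [hA, hB, smul_mul_assoc, mul_smul_comm] at h3
    have h4 := smul_right_injective _ hc h3
    rw [sub_mul, mul_sub, mul_smul_comm, h2] at h4
    rw [one_smul]
    exact sub_left_injective h4

theorem par_cases : (par N = 0 ∧ ¬ Even N) ∨ (par N = 1 ∧ Even N) := by
  unfold par; split_ifs <;> simp [*]

/-- At the bottom only p^0, or the commuting pair p^{±1}, occurs. In the inductive step an old index
meets one new factor on each side of it, and the powers q^{-1} and q cancel; the new indices are
`qcommute_sqMom_succ`. -/
theorem qcommute_sqMom_of_abs_le (hq : 0 < q) {l : ℕ} (hl : par N ≤ l) (hln : l ≤ rk N) {i : ℤ}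
    (hi : |i| ≤ l) : QCommute 1 (sqMom q N l) (mom q N i) := by
  have hq' : (q : ℂ) ≠ 0 := by exact_mod_cast hq.ne'
  induction l, hl using Nat.le_induction with
  | base =>
    rcases par_cases (N := N) with ⟨h, hN⟩ | ⟨h, hN⟩
    · rw [h] at hi ⊢
      obtain rfl : i = 0 := by simpa using hi
      rw [sqMom_zero_odd hN]
      refine QCommute.smul_left _ ?_
      simp [QCommute, mul_assoc]
    · rw [h] at hi hln ⊢
      have hc := mom_one_comm_even (q := q) hN hln
      rw [sqMom_succ, sqMom_zero_even hN, zero_add]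
      refine QCommute.smul_left _ ?_
      rw [abs_le] at hi
      obtain ⟨h1, h2⟩ := hi
      simp only [Nat.cast_one, Nat.cast_zero, zero_add] at h1 h2 ⊢
      interval_cases i
      · simp [QCommute, mul_assoc, hc]
      · rw [mom_zero_even hN]; exact .zero_right _ _
      · simp only [QCommute, one_smul, ← mul_assoc, hc]
  | succ l hl ih =>
    by_cases hi' : |i| ≤ l
    · rw [sqMom_succ]
      refine (QCommute.symm (d := 1) (c := 1) ?_ (by norm_num))
      refine QCommute.add_right ((ih (by omega) hi').symm (by norm_num)) (.smul_right _ ?_)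
      rw [abs_le] at hi'
      have := (mom_qcommute' (N := N) hq (i := -((l : ℤ) + 1)) (j := i) (by omega)
        (by omega)).mul_right
        (mom_qcommute (N := N) (i := i) (j := (l : ℤ) + 1) (by omega) (by omega))
      rwa [inv_mul_cancel₀ hq'] at this
    · have := qcommute_sqMom_succ hq hl hln
      push_cast at hi
      have h3 : i = (l : ℤ) + 1 ∨ i = -((l : ℤ) + 1) := by
        rcases abs_cases i with h | h <;> omega
      rcases h3 with rfl | rfl
      · exact this.1
      · exact this.2

theorem qcommute_sqMom_mom (hq : 0 < q) {l : ℕ} (hl : par N ≤ l) (hln : l ≤ rk N) (i : ℤ) :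
    QCommute (weight q l i : ℂ) (sqMom q N l) (mom q N i) := by
  unfold weight
  split_ifs with h1 h2
  · push_cast; exact qcommute_sqMom_of_lt hq h1
  · push_cast; exact qcommute_sqMom_of_lt_neg hq h2
  · push_cast; exact qcommute_sqMom_of_abs_le hq hl hln (by rw [abs_le]; omega)

theorem qcommute_sqMom_lam (hq : 0 < q) (l : ℕ) :
    QCommute ((q ^ 2 : ℝ) : ℂ) (sqMom q N l) (gen q N .lam) := by
  have hq' : (q : ℂ) ≠ 0 := by exact_mod_cast hq.ne'
  have h : ∀ i, QCommute (q : ℂ)⁻¹ (gen q N .lam) (mom q N i) := fun i => by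
    have := qcommute_of_rel (Rel.lam_p (q := q) (N := N) i)
    rw [qp_neg hq, qp_one] at this
    exact this
  exact QCommute.symm (c := (q : ℂ)⁻¹ * (q : ℂ)⁻¹)
    (QCommute.sqMom (fun j _ => (h _).mul_right (h _)) fun _ => (h _).mul_right (h _))
    (by push_cast; field_simp)

theorem lam_mul_lamInv : gen q N .lam * gen q N .lamInv = 1 := by
  have := toAlg_rel (Rel.lam_lamInv (q := q) (N := N))
  rwa [map_mul, map_one] at this

theorem lamInv_mul_lam : gen q N .lamInv * gen q N .lam = 1 := by
  have := toAlg_rel (Rel.lamInv_lam (q := q) (N := N))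
  rwa [map_mul, map_one] at this

theorem qcommute_sqMom_lamInv (hq : 0 < q) (l : ℕ) :
    QCommute (((q ^ 2)⁻¹ : ℝ) : ℂ) (sqMom q N l) (gen q N .lamInv) := by
  have hq' : (q : ℂ) ≠ 0 := by exact_mod_cast hq.ne'
  have h := qcommute_sqMom_lam (N := N) hq l
  unfold QCommute at *
  have h2 := congrArg (fun x => gen q N .lamInv * x * gen q N .lamInv) h
  simp only [mul_smul_comm, smul_mul_assoc, mul_assoc, lam_mul_lamInv, mul_one] at h2
  rw [← mul_assoc (gen q N .lamInv) (gen q N .lam), lamInv_mul_lam, one_mul] at h2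
  rw [h2, smul_smul, Complex.ofReal_inv, inv_mul_cancel₀ (by simpa using hq'), one_smul]

theorem kd_neg (i j : ℤ) : kd (-i) j = kd i (-j) := by
  simp only [kd, neg_eq_iff_eq_neg]

/-- p^j and p^{-j} have inverse weights under k^i, so each summand of `(p·p)_l` has weight one. -/
theorem qcommute_sqMom_k (hq : 0 < q) (l : ℕ) (i : ℤ) :
    QCommute 1 (sqMom q N l) (gen q N (.k i)) := by
  have key : ∀ i, 1 ≤ i → QCommute 1 (sqMom q N l) (gen q N (.k i)) := by
    intro i hi
    have hp : ∀ j, QCommute (qp q (2 * (kd j i - kd j (-i)))) (gen q N (.k i)) (mom q N j) := by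
      intro j
      by_cases hj : IsIdx N j
      · exact qcommute_of_rel (Rel.k_p i j hi hj)
      · rw [mom_eq_zero hj]; exact .zero_right _ _
    refine QCommute.symm (c := 1) (QCommute.sqMom (fun j _ => ?_) fun _ => ?_) (by norm_num)
    · have := (hp (-((j : ℤ) + 1))).mul_right (hp ((j : ℤ) + 1))
      rw [← qp_add hq] at this
      convert this using 1
      rw [← qp_zero q]
      congr 1
      rw [kd_neg, kd_neg, neg_neg]
      ring
    · have := (hp 0).mul_right (hp 0)
      rw [← qp_add hq] at this
      convert this using 1
      rw [← qp_zero q]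
      congr 1
      simp only [kd, zero_eq_neg]
      rw [if_neg (by omega), eq_comm]
      simp [show i ≠ 0 by omega]
  have hinv : ∀ i, gen q N (.k i) * gen q N (.k (-i)) = 1 := fun i => by
    have := toAlg_rel (Rel.k_inv (q := q) (N := N) i)
    rwa [map_mul, map_one] at this
  rcases lt_trichotomy i 0 with h | rfl | h
  · refine QCommute.inv_right (key (-i) (by omega)) ?_ (hinv i)
    simpa using hinv (-i)
  · have := toAlg_rel (Rel.k_triv (q := q) (N := N) 0 (Or.inl rfl))
    rw [map_one] at this
    rw [show gen q N (.k 0) = 1 from this]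
    exact .one_right _
  · exact key i (by omega)

/-! ### Simple root vectors and the squared momenta -/

section Ring

variable {A : Type*} [Ring A] [Algebra ℂ A] {x y z w : A} {c d e : ℂ}

/-- Leibniz rules for q-commutators: when the twists of the two factors are inverse to each other,
the product satisfies an ordinary commutator with a single defect term. -/
theorem QCommute.mul_mul (h : QCommute c x y) (h' : x * z = d • (z * x) + e • w)
    (hcd : c * d = 1) : x * (y * z) = y * z * x + (c * e) • (y * w) := by
  unfold QCommute at h
  rw [← mul_assoc, h, smul_mul_assoc, mul_assoc, h', mul_add, smul_add, mul_smul_comm,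
    mul_smul_comm, smul_smul, smul_smul, hcd, one_smul, mul_assoc]

theorem QCommute.mul_mul' (h : QCommute d x z) (h' : x * y = c • (y * x) + e • w)
    (hcd : c * d = 1) : x * (y * z) = y * z * x + e • (w * z) := by
  unfold QCommute at h
  rw [← mul_assoc, h', add_mul, smul_mul_assoc, smul_mul_assoc, mul_assoc, h, mul_smul_comm,
    smul_smul, hcd, one_smul, mul_assoc]

theorem QCommute.mul_self (h : QCommute c y w) (h' : x * y = y * x + e • w) :
    x * (y * y) = y * y * x + (e * (1 + c)) • (w * y) := by
  unfold QCommute at h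
  rw [← mul_assoc, h', add_mul, smul_mul_assoc, mul_assoc, h', mul_add, mul_smul_comm, h,
    mul_assoc]
  module

theorem mul_add_smul_comm {s s' t : A} (h : x * s = s * x + d • w)
    (h' : x * t = t * x + e • w) (hs : s' = s + c • t) :
    x * s' = s' * x + (d + c * e) • w := by
  rw [hs, mul_add, add_mul, h, mul_smul_comm, h', smul_mul_assoc]
  module

end Ring

/-- The number l = m - 1 is the level of the only squared momentum with which the root vectors of
(a, m) may fail to commute. -/
theorem IsSimple.exists_nat {a m : ℤ} (h : IsSimple N a m) :
    ∃ l : ℕ, m = (l : ℤ) + 1 ∧ par N ≤ l ∧ l + 1 ≤ rk N ∧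
      (a = l ∨ (Even N ∧ a = -1 ∧ l = 1)) := by
  rcases h with ⟨h1, h2, h3⟩ | ⟨hN, h1, h2, h3⟩
  · exact ⟨(m - 1).toNat, by omega, by omega, by omega, by omega⟩
  · exact ⟨1, by omega, by simp [par, hN], by omega, Or.inr ⟨hN, h1, rfl⟩⟩

theorem raise_qcommute_mom {a m : ℤ} (h : IsSimple N a m) {i : ℤ} (hia : i ≠ a) (him : i ≠ -m) :
    QCommute (qp q ((kd i a - kd i (-a)) - (kd i m - kd i (-m))))
      (gen q N (.raise a m)) (mom q N i) := by
  by_cases hi : IsIdx N i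
  · exact qcommute_of_rel (Rel.raise_p_other a m i h hi hia him)
  · rw [mom_eq_zero hi]; exact .zero_right _ _

theorem lower_qcommute_mom {a m : ℤ} (h : IsSimple N a m) {i : ℤ} (him : i ≠ m) (hia : i ≠ -a) :
    QCommute (qp q ((kd i a - kd i (-a)) - (kd i m - kd i (-m))))
      (gen q N (.lower a m)) (mom q N i) := by
  by_cases hi : IsIdx N i
  · exact qcommute_of_rel (Rel.lower_p_other a m i h hi him hia)
  · rw [mom_eq_zero hi]; exact .zero_right _ _

theorem kd_self (i : ℤ) : kd i i = 1 := if_pos rfl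

theorem kd_of_ne {i j : ℤ} (h : i ≠ j) : kd i j = 0 := if_neg h

theorem raise_commute_mom {a m : ℤ} (h : IsSimple N a m) {i : ℤ} (hia : i ≠ a) (hia' : i ≠ -a)
    (him : i ≠ m) (him' : i ≠ -m) : QCommute 1 (gen q N (.raise a m)) (mom q N i) := by
  simpa [kd, *, qp_zero] using raise_qcommute_mom (q := q) h hia him'

theorem lower_commute_mom {a m : ℤ} (h : IsSimple N a m) {i : ℤ} (hia : i ≠ a) (hia' : i ≠ -a)
    (him : i ≠ m) (him' : i ≠ -m) : QCommute 1 (gen q N (.lower a m)) (mom q N i) := by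
  simpa [kd, *, qp_zero] using lower_qcommute_mom (q := q) h him hia'

theorem toAlg_smul_p (c : ℂ) (i : ℤ) : toAlg q N (c • Free.p i) = c • mom q N i := map_smul _ _ _

theorem raise_mul_mom_top {a m : ℤ} (h : IsSimple N a m) (ha : a ≠ 0) :
    gen q N (.raise a m) * mom q N a =
      (q : ℂ) • (mom q N a * gen q N (.raise a m)) + (-qp q (rho N m)) • mom q N m := by
  have := mul_eq_of_rel (Rel.raise_p_top (q := q) a m h ha)
  rw [qp_one, ← neg_smul, toAlg_smul_p] at this
  exact this

theorem raise_mul_mom_bot {a m : ℤ} (h : IsSimple N a m) :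
    gen q N (.raise a m) * mom q N (-m) =
      (q : ℂ) • (mom q N (-m) * gen q N (.raise a m)) + qp q (rho N m) • mom q N (-a) := by
  have := mul_eq_of_rel (Rel.raise_p_bot (q := q) a m h)
  rw [qp_one, toAlg_smul_p] at this
  exact this

theorem raise_mul_mom_zero (hq : 0 < q) (h : IsSimple N 0 1) :
    gen q N (.raise 0 1) * mom q N 0 =
      mom q N 0 * gen q N (.raise 0 1) + (-(q : ℂ)⁻¹) • mom q N 1 := by
  have := mul_eq_of_rel (Rel.raise_p_zero (q := q) h)
  rw [qp_neg hq, qp_one, ← neg_smul, toAlg_smul_p, one_smul] at this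
  exact this

theorem lower_mul_mom_top (hq : 0 < q) {a m : ℤ} (h : IsSimple N a m) :
    gen q N (.lower a m) * mom q N m =
      (q : ℂ)⁻¹ • (mom q N m * gen q N (.lower a m)) + (-qp q (rho N m)) • mom q N a := by
  have := mul_eq_of_rel (Rel.lower_p_top (q := q) a m h)
  rw [qp_neg hq, qp_one, ← neg_smul, toAlg_smul_p] at this
  exact this

theorem lower_mul_mom_bot (hq : 0 < q) {a m : ℤ} (h : IsSimple N a m) (ha : a ≠ 0) :
    gen q N (.lower a m) * mom q N (-a) =
      (q : ℂ)⁻¹ • (mom q N (-a) * gen q N (.lower a m)) + qp q (rho N m) • mom q N (-m) := by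
  have := mul_eq_of_rel (Rel.lower_p_bot (q := q) a m h ha)
  rw [qp_neg hq, qp_one, toAlg_smul_p] at this
  exact this

theorem lower_mul_mom_zero (h : IsSimple N 0 1) :
    gen q N (.lower 0 1) * mom q N 0 =
      mom q N 0 * gen q N (.lower 0 1) + (1 : ℂ) • mom q N (-1) := by
  have := mul_eq_of_rel (Rel.lower_p_zero (q := q) h)
  rw [one_smul] at this ⊢
  exact this

theorem sqMom_one_even (hN : Even N) : sqMom q N 1 = mom q N (-1) * mom q N 1 := by
  have h := sqMom_succ (q := q) (N := N) 0
  have hr := rho_succ (N := N) 0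
  simp [hN] at hr
  rw [sqMom_zero_even hN] at h
  simpa [hr, qp_zero] using h

/-- The commutator of a positive simple root vector with `(p·p)_{m-1}`. -/
theorem raise_mul_sqMom (hq : 0 < q) {a : ℤ} {l : ℕ} (h : IsSimple N a ((l : ℤ) + 1))
    (ha : a = l ∨ (Even N ∧ a = -1 ∧ l = 1)) :
    gen q N (.raise a ((l : ℤ) + 1)) * sqMom q N l =
      sqMom q N l * gen q N (.raise a ((l : ℤ) + 1)) +
        (-qp q (2 * rho N ((l : ℤ) + 1))) • (mom q N (-a) * mom q N ((l : ℤ) + 1)) := by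
  have hq' : (q : ℂ) ≠ 0 := by exact_mod_cast hq.ne'
  rcases ha with rfl | ⟨hN, rfl, rfl⟩
  · rcases l with _ | l
    · have hN : ¬ Even N := by
        rcases h with ⟨_, h, _⟩ | ⟨_, h, _⟩
        · rcases par_cases (N := N) with h' | h' <;> [exact h'.2; omega]
        · omega
      have hr := rho_succ (N := N) 0
      rw [if_neg hN] at hr
      rw [hr, show (2 * ((1 : ℝ) / 2 - ((0 : ℕ) + 1))) = -1 by norm_num, qp_neg hq, qp_one]
      simp only [Nat.cast_zero, zero_add, neg_zero] at h ⊢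
      have hc := mom_qcommute (q := q) (N := N) (i := 0) (j := 1) (by omega) (by omega)
      have hc' := mom_qcommute' (N := N) hq (i := 0) (j := 1) (by omega) (by omega)
      -- Crossing p^0 twice produces a factor 1 + q, which the normalization 1 + q⁻¹ absorbs up to a
      -- power of q.
      have h2 := hc.mul_self (raise_mul_mom_zero hq h)
      rw [sqMom_zero_odd hN, mul_smul_comm, h2, hc', smul_add, smul_smul, smul_smul,
        smul_mul_assoc]
      have h1 : (1 + q : ℂ) ≠ 0 := by exact_mod_cast (by positivity : (1 + q : ℝ) ≠ 0)
      have h1' : (1 + (q : ℂ)⁻¹) = (1 + q) * (q : ℂ)⁻¹ := by field_simp; ring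
      congr 2
      push_cast
      rw [h1']
      field_simp
    -- Only the last summand p^{-(l+1)} p^{l+1} matters: the root vector commutes with `(p·p)_l`,
    -- and inside that summand only p^{l+1} produces a defect.
    · have h1 : QCommute 1 (gen q N (.raise ((l + 1 : ℕ) : ℤ) (((l + 1 : ℕ) : ℤ) + 1)))
          (sqMom q N l) := by
        have := fun (i : ℤ) (hi : |i| ≤ l) => raise_commute_mom (q := q) h (i := i)
          (by rw [abs_le] at hi; push_cast; omega) (by rw [abs_le] at hi; push_cast; omega)
          (by rw [abs_le] at hi; push_cast; omega) (by rw [abs_le] at hi; push_cast; omega)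
        refine QCommute.sqMom (fun j hj => ?_) (fun _ => ?_)
        · simpa using (this (-((j : ℤ) + 1)) (by rw [abs_le]; omega)).mul_right
            (this ((j : ℤ) + 1) (by rw [abs_le]; omega))
        · simpa using (this 0 (by simp)).mul_right (this 0 (by simp))
      have h3 := raise_qcommute_mom (q := q) h (i := -((l + 1 : ℕ) : ℤ)) (by omega)
        (by omega)
      rw [show kd (-((l + 1 : ℕ) : ℤ)) ((l + 1 : ℕ) : ℤ) - kd (-((l + 1 : ℕ) : ℤ)) (-((l + 1 : ℕ) : ℤ)) -
        (kd (-((l + 1 : ℕ) : ℤ)) (((l + 1 : ℕ) : ℤ) + 1) -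
          kd (-((l + 1 : ℕ) : ℤ)) (-(((l + 1 : ℕ) : ℤ) + 1))) = -1 by
          rw [kd_self, kd_of_ne (by omega), kd_of_ne (by omega), kd_of_ne (by omega)]
          norm_num, qp_neg hq, qp_one] at h3
      have h4 := h3.mul_mul (raise_mul_mom_top (q := q) h (by omega)) (inv_mul_cancel₀ hq')
      have h5 := mul_add_smul_comm (d := 0) (by rw [zero_smul, add_zero, h1, one_smul]) h4
        (by simpa using sqMom_succ (q := q) (N := N) l)
      rw [h5]
      congr 2
      push_cast
      rw [rho_succ_succ, show 2 * (rho N ((l : ℤ) + 1) - 1) =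
        rho N ((l : ℤ) + 1) + (-1 + (rho N ((l : ℤ) + 1) - 1)) by ring, qp_add hq (rho N _) (-1 + _),
        qp_add hq (-1) (rho N _ - _), qp_neg hq, qp_one]
      ring
  -- The exceptional root of even N: in `(p·p)_1` = p^{-1} p^1 the defect p^2 comes from p^{-1} and
  -- has to be moved past p^1.
  · have h3 := raise_qcommute_mom (q := q) h (i := 1) (by omega) (by norm_num)
    have hr := rho_succ (N := N) 1
    simp only [hN, if_true] at hr
    rw [hr, sqMom_one_even hN]
    simp [kd, qp_neg hq, qp_one] at h3
    have h2 := raise_mul_mom_top (q := q) h (by omega)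
    have h4 := h3.mul_mul' h2 (mul_inv_cancel₀ hq')
    have hc := (mom_qcommute' (N := N) hq (i := 1) (j := 2) (by omega) (by omega))
    unfold QCommute at hc
    rw [hr] at h4
    norm_num at h4 ⊢
    rw [h4, hc, smul_smul]
    congr 2
    rw [show (-2 : ℝ) = -1 + -1 by norm_num, qp_add hq, qp_neg hq, qp_one]
    ring

/-- The commutator of a negative simple root vector with `(p·p)_{m-1}`. -/
theorem lower_mul_sqMom (hq : 0 < q) {a : ℤ} {l : ℕ} (h : IsSimple N a ((l : ℤ) + 1))
    (ha : a = l ∨ (Even N ∧ a = -1 ∧ l = 1)) :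
    gen q N (.lower a ((l : ℤ) + 1)) * sqMom q N l =
      sqMom q N l * gen q N (.lower a ((l : ℤ) + 1)) +
        qp q (1 + 2 * rho N ((l : ℤ) + 1)) • (mom q N (-((l : ℤ) + 1)) * mom q N a) := by
  have hq' : (q : ℂ) ≠ 0 := by exact_mod_cast hq.ne'
  rcases ha with rfl | ⟨hN, rfl, rfl⟩
  · rcases l with _ | l
    · have hN : ¬ Even N := by
        rcases h with ⟨_, h, _⟩ | ⟨_, h, _⟩
        · rcases par_cases (N := N) with h' | h' <;> [exact h'.2; omega]
        · omega
      have hr := rho_succ (N := N) 0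
      rw [if_neg hN] at hr
      rw [hr, show (1 + 2 * ((1 : ℝ) / 2 - ((0 : ℕ) + 1))) = 0 by norm_num, qp_zero]
      simp only [Nat.cast_zero, zero_add] at h ⊢
      have hc := mom_qcommute' (q := q) (N := N) hq (i := -1) (j := 0) (by omega) (by omega)
      have h2 := hc.mul_self (lower_mul_mom_zero h)
      rw [sqMom_zero_odd hN, mul_smul_comm, h2, smul_add, smul_smul, smul_mul_assoc]
      have h1 : (1 + q : ℂ) ≠ 0 := by exact_mod_cast (by positivity : (1 + q : ℝ) ≠ 0)
      have h1' : (1 + (q : ℂ)⁻¹) = (1 + q) * (q : ℂ)⁻¹ := by field_simp; ring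
      congr 2
      push_cast
      rw [h1']
      field_simp
    · have h1 : QCommute 1 (gen q N (.lower ((l + 1 : ℕ) : ℤ) (((l + 1 : ℕ) : ℤ) + 1)))
          (sqMom q N l) := by
        have := fun (i : ℤ) (hi : |i| ≤ l) => lower_commute_mom (q := q) h (i := i)
          (by rw [abs_le] at hi; push_cast; omega) (by rw [abs_le] at hi; push_cast; omega)
          (by rw [abs_le] at hi; push_cast; omega) (by rw [abs_le] at hi; push_cast; omega)
        refine QCommute.sqMom (fun j hj => ?_) (fun _ => ?_)
        · simpa using (this (-((j : ℤ) + 1)) (by rw [abs_le]; omega)).mul_right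
            (this ((j : ℤ) + 1) (by rw [abs_le]; omega))
        · simpa using (this 0 (by simp)).mul_right (this 0 (by simp))
      have h3 := lower_qcommute_mom (q := q) h (i := ((l + 1 : ℕ) : ℤ)) (by omega)
        (by omega)
      rw [show kd ((l + 1 : ℕ) : ℤ) ((l + 1 : ℕ) : ℤ) - kd ((l + 1 : ℕ) : ℤ) (-((l + 1 : ℕ) : ℤ)) -
        (kd ((l + 1 : ℕ) : ℤ) (((l + 1 : ℕ) : ℤ) + 1) -
          kd ((l + 1 : ℕ) : ℤ) (-(((l + 1 : ℕ) : ℤ) + 1))) = 1 by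
          rw [kd_self, kd_of_ne (by omega), kd_of_ne (by omega), kd_of_ne (by omega)]
          norm_num, qp_one] at h3
      -- Mirror image of the positive case: the defect now comes from p^{-(l+1)}.
      have h4 := h3.mul_mul' (lower_mul_mom_bot hq h (by omega)) (inv_mul_cancel₀ hq')
      have h5 := mul_add_smul_comm (d := 0) (by rw [zero_smul, add_zero, h1, one_smul]) h4
        (by simpa using sqMom_succ (q := q) (N := N) l)
      rw [h5]
      congr 2
      push_cast
      rw [rho_succ_succ, show 1 + 2 * (rho N ((l : ℤ) + 1) - 1) =
        rho N ((l : ℤ) + 1) + (rho N ((l : ℤ) + 1) - 1) by ring, qp_add hq (rho N _) (_ - _)]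
      ring
  · have h3 := lower_qcommute_mom (q := q) h (i := -1) (by omega) (by norm_num)
    have hr := rho_succ (N := N) 1
    simp only [hN, if_true] at hr
    rw [hr, sqMom_one_even hN]
    simp [kd, qp_one] at h3
    have h2 := lower_mul_mom_bot hq h (by omega)
    have h4 := h3.mul_mul h2 (mul_inv_cancel₀ hq')
    have hc := (mom_qcommute' (N := N) hq (i := -2) (j := -1) (by omega) (by omega))
    unfold QCommute at hc
    rw [hr] at h4
    norm_num at h4 ⊢
    rw [h4, hc, smul_smul]
    congr 2
    rw [qp_neg hq, qp_one]
    field_simp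

/-- Positive simple root vectors commute with the other squared momenta. -/
theorem raise_qcommute_sqMom (hq : 0 < q) {a : ℤ} {l : ℕ} (h : IsSimple N a ((l : ℤ) + 1))
    (ha : a = l ∨ (Even N ∧ a = -1 ∧ l = 1)) {j : ℕ} (hj : par N ≤ j) (hjl : j ≠ l) :
    QCommute 1 (gen q N (.raise a ((l : ℤ) + 1))) (sqMom q N j) := by
  have hq' : (q : ℂ) ≠ 0 := by exact_mod_cast hq.ne'
  have ha' : a = l ∨ (a = -1 ∧ l = 1) := by tauto
  have hpar := par_cases (N := N)
  rcases Nat.lt_or_gt_of_ne hjl with hlt | hlt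
  -- The exceptional root has l = 1 = h, which leaves no admissible j < l.
  · obtain rfl : a = l := by
      rcases ha with h | ⟨hN, h1, h2⟩
      · exact h
      · rcases hpar with ⟨h3, h4⟩ | ⟨h3, h4⟩ <;> [exact absurd hN h4; omega]
    have := fun (i : ℤ) (hi : |i| ≤ j) => raise_commute_mom (q := q) h (i := i)
      (by rw [abs_le] at hi; omega) (by rw [abs_le] at hi; omega)
      (by rw [abs_le] at hi; omega) (by rw [abs_le] at hi; omega)
    refine QCommute.sqMom (fun i hi => ?_) (fun _ => ?_)
    · simpa using (this (-((i : ℤ) + 1)) (by rw [abs_le]; omega)).mul_right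
        (this ((i : ℤ) + 1) (by rw [abs_le]; omega))
    · simpa using (this 0 (by simp)).mul_right (this 0 (by simp))
  · induction j, (show l + 1 ≤ j from hlt) using Nat.le_induction with
    | base =>
      have h3 := raise_qcommute_mom (q := q) h (i := (l : ℤ) + 1) (by omega) (by omega)
      rw [show kd ((l : ℤ) + 1) a - kd ((l : ℤ) + 1) (-a) -
        (kd ((l : ℤ) + 1) ((l : ℤ) + 1) - kd ((l : ℤ) + 1) (-((l : ℤ) + 1))) = -1 by
          rw [kd_self, kd_of_ne (by omega), kd_of_ne (by omega), kd_of_ne (by omega)]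
          norm_num, qp_neg hq, qp_one] at h3
      have h4 := h3.mul_mul' (raise_mul_mom_bot (q := q) h) (mul_inv_cancel₀ hq')
      -- The defects of `(p·p)_l` and of the new summand p^{-(l+1)} p^{l+1} cancel.
      have h5 := mul_add_smul_comm (raise_mul_sqMom hq h ha) h4 (sqMom_succ (q := q) l)
      rw [two_mul, qp_add hq, neg_add_cancel, zero_smul, add_zero] at h5
      rw [QCommute, one_smul]; exact h5
    | succ j hjl' ih =>
      rw [sqMom_succ]
      refine (ih (by omega) (by omega) (by omega)).add_right (.smul_right _ ?_)
      simpa using (raise_commute_mom (q := q) h (i := -((j : ℤ) + 1)) (by omega) (by omega)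
        (by omega) (by omega)).mul_right (raise_commute_mom (q := q) h (i := (j : ℤ) + 1)
          (by omega) (by omega) (by omega) (by omega))

/-- Negative simple root vectors commute with the other squared momenta. -/
theorem lower_qcommute_sqMom (hq : 0 < q) {a : ℤ} {l : ℕ} (h : IsSimple N a ((l : ℤ) + 1))
    (ha : a = l ∨ (Even N ∧ a = -1 ∧ l = 1)) {j : ℕ} (hj : par N ≤ j) (hjl : j ≠ l) :
    QCommute 1 (gen q N (.lower a ((l : ℤ) + 1))) (sqMom q N j) := by
  have hq' : (q : ℂ) ≠ 0 := by exact_mod_cast hq.ne'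
  have ha' : a = l ∨ (a = -1 ∧ l = 1) := by tauto
  have hpar := par_cases (N := N)
  rcases Nat.lt_or_gt_of_ne hjl with hlt | hlt
  · obtain rfl : a = l := by
      rcases ha with h | ⟨hN, h1, h2⟩
      · exact h
      · rcases hpar with ⟨h3, h4⟩ | ⟨h3, h4⟩ <;> [exact absurd hN h4; omega]
    have := fun (i : ℤ) (hi : |i| ≤ j) => lower_commute_mom (q := q) h (i := i)
      (by rw [abs_le] at hi; omega) (by rw [abs_le] at hi; omega)
      (by rw [abs_le] at hi; omega) (by rw [abs_le] at hi; omega)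
    refine QCommute.sqMom (fun i hi => ?_) (fun _ => ?_)
    · simpa using (this (-((i : ℤ) + 1)) (by rw [abs_le]; omega)).mul_right
        (this ((i : ℤ) + 1) (by rw [abs_le]; omega))
    · simpa using (this 0 (by simp)).mul_right (this 0 (by simp))
  · induction j, (show l + 1 ≤ j from hlt) using Nat.le_induction with
    | base =>
      have h3 := lower_qcommute_mom (q := q) h (i := -((l : ℤ) + 1)) (by omega) (by omega)
      rw [show kd (-((l : ℤ) + 1)) a - kd (-((l : ℤ) + 1)) (-a) -
        (kd (-((l : ℤ) + 1)) ((l : ℤ) + 1) - kd (-((l : ℤ) + 1)) (-((l : ℤ) + 1))) = 1 by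
          rw [kd_self, kd_of_ne (by omega), kd_of_ne (by omega), kd_of_ne (by omega)]
          norm_num, qp_one] at h3
      have h4 := h3.mul_mul (lower_mul_mom_top hq h) (mul_inv_cancel₀ hq')
      have h5 := mul_add_smul_comm (lower_mul_sqMom hq h ha) h4 (sqMom_succ (q := q) l)
      rw [two_mul, qp_add hq, qp_add hq, qp_one, show
        (q : ℂ) * (qp q (rho N ((l : ℤ) + 1)) * qp q (rho N ((l : ℤ) + 1))) +
        qp q (rho N ((l : ℤ) + 1)) * (q * -qp q (rho N ((l : ℤ) + 1))) = 0 by ring,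
        zero_smul, add_zero] at h5
      rw [QCommute, one_smul]; exact h5
    | succ j hjl' ih =>
      rw [sqMom_succ]
      refine (ih (by omega) (by omega) (by omega)).add_right (.smul_right _ ?_)
      simpa using (lower_commute_mom (q := q) h (i := -((j : ℤ) + 1)) (by omega) (by omega)
        (by omega) (by omega)).mul_right (lower_commute_mom (q := q) h (i := (j : ℤ) + 1)
          (by omega) (by omega) (by omega) (by omega))

/-! ### Squared momenta in a Hilbert space representation -/

namespace HilbertRep

variable {H : Type*} [NormedAddCommGroup H] [InnerProductSpace ℂ H] (Γ : HilbertRep q N H)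

theorem act_mul_apply (x y : Alg q N) (v : Γ.dom) : Γ.act (x * y) v = Γ.act x (Γ.act y v) := by
  rw [map_mul]; rfl

theorem act_add_apply (x y : Alg q N) (v : Γ.dom) : Γ.act (x + y) v = Γ.act x v + Γ.act y v := by
  rw [map_add]; rfl

theorem act_sub_apply (x y : Alg q N) (v : Γ.dom) : Γ.act (x - y) v = Γ.act x v - Γ.act y v := by
  rw [map_sub]; rfl

theorem act_smul_apply (c : ℂ) (x : Alg q N) (v : Γ.dom) : Γ.act (c • x) v = c • Γ.act x v := by
  rw [map_smul]; rfl

theorem act_one_apply (v : Γ.dom) : Γ.act 1 v = v := by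
  rw [map_one]; rfl

theorem act_zero_apply (v : Γ.dom) : Γ.act 0 v = 0 := by
  rw [map_zero]; rfl

theorem act_qcommute {c : ℂ} {x y : Alg q N} (h : QCommute c x y) (v : Γ.dom) :
    Γ.act x (Γ.act y v) = c • Γ.act y (Γ.act x v) := by
  rw [← act_mul_apply, h, act_smul_apply, act_mul_apply]

theorem inner_self_eq_ofReal (v : Γ.dom) : ⟪v, v⟫_ℂ = ((‖v‖ ^ 2 : ℝ) : ℂ) := by
  rw [inner_self_eq_norm_sq_to_K]; norm_cast

theorem inner_mom_left (i : ℤ) (u v : Γ.dom) :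
    ⟪Γ.act (mom q N i) u, v⟫_ℂ = qp q (rho N i) * ⟪u, Γ.act (mom q N (-i)) v⟫_ℂ := by
  rw [Γ.act_star, starGen, act_smul_apply, inner_smul_right]

theorem inner_sqMom_left (hq : 0 < q) (l : ℕ) (u v : Γ.dom) :
    ⟪Γ.act (sqMom q N l) u, v⟫_ℂ = ⟪u, Γ.act (sqMom q N l) v⟫_ℂ := by
  induction l with
  | zero =>
    by_cases hN : Even N
    · simp [sqMom_zero_even hN]
    · rw [sqMom_zero_odd hN, act_smul_apply, act_smul_apply, inner_smul_left, inner_smul_right,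
        act_mul_apply, act_mul_apply, inner_mom_left, inner_mom_left, rho_zero, qp_zero, neg_zero,
        ← Complex.ofReal_inv, Complex.conj_ofReal, one_mul, one_mul]
  | succ l ih =>
    rw [sqMom_succ, act_add_apply, act_add_apply, inner_add_left, inner_add_right, ih,
      act_smul_apply, act_smul_apply, inner_smul_left, inner_smul_right, act_mul_apply,
      act_mul_apply, inner_mom_left, inner_mom_left, neg_neg, rho_neg, qp, Complex.conj_ofReal]
    congr 1
    have h : qp q (rho N ((l : ℤ) + 1)) * qp q (-rho N ((l : ℤ) + 1)) = 1 := by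
      rw [← qp_add hq, add_neg_cancel, qp_zero]
    unfold qp at h ⊢
    linear_combination (((q ^ rho N ((l : ℤ) + 1) : ℝ) : ℂ) *
      ⟪u, Γ.act (mom q N (-((l : ℤ) + 1))) (Γ.act (mom q N ((l : ℤ) + 1)) v)⟫_ℂ) * h

theorem inner_mom_self (l : ℕ) (v : Γ.dom) :
    ⟪Γ.act (mom q N ((l : ℤ) + 1)) v, Γ.act (mom q N ((l : ℤ) + 1)) v⟫_ℂ =
      ⟪v, Γ.act (sqMom q N (l + 1)) v⟫_ℂ - ⟪v, Γ.act (sqMom q N l) v⟫_ℂ := by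
  rw [inner_mom_left, sqMom_succ, act_add_apply, inner_add_right, act_smul_apply,
    inner_smul_right, act_mul_apply]
  ring

theorem inner_mom_zero_self (hq : 0 < q) (hN : ¬ Even N) (v : Γ.dom) :
    ⟪Γ.act (mom q N 0) v, Γ.act (mom q N 0) v⟫_ℂ =
      ((1 + q⁻¹ : ℝ) : ℂ) * ⟪v, Γ.act (sqMom q N 0) v⟫_ℂ := by
  rw [inner_mom_left, sqMom_zero_odd hN, act_smul_apply, inner_smul_right, act_mul_apply,
    rho_zero, qp_zero, neg_zero, one_mul, mul_inv_cancel_left₀]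
  exact_mod_cast (by positivity : (1 + q⁻¹ : ℝ) ≠ 0)

theorem inner_mom_neg_self (hq : 0 < q) {l : ℕ} (hl : par N ≤ l) (hln : l + 1 ≤ rk N)
    (v : Γ.dom) :
    ⟪Γ.act (mom q N (-((l : ℤ) + 1))) v, Γ.act (mom q N (-((l : ℤ) + 1))) v⟫_ℂ =
      qp q (-(2 * rho N ((l : ℤ) + 1))) * (⟪v, Γ.act (sqMom q N (l + 1)) v⟫_ℂ -
        ((q : ℂ) ^ 2)⁻¹ * ⟪v, Γ.act (sqMom q N l) v⟫_ℂ) := by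
  rw [inner_mom_left, neg_neg, ← act_mul_apply, mom_mul_mom_neg hq hl hln, act_smul_apply,
    inner_smul_right, act_sub_apply, inner_sub_right, act_smul_apply, inner_smul_right, rho_neg,
    two_mul, neg_add, qp_add hq, qp_neg hq, qp_neg hq 2, ← mul_assoc]
  congr 4
  norm_num [qp]

theorem sqMom_nonneg (hq : 0 < q) (l : ℕ) (v : Γ.dom) :
    0 ≤ (⟪v, Γ.act (sqMom q N l) v⟫_ℂ).re := by
  induction l with
  | zero =>
    by_cases hN : Even N
    · simp [sqMom_zero_even hN]
    · have h := congrArg Complex.re (Γ.inner_mom_zero_self hq hN v)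
      rw [Complex.re_ofReal_mul] at h
      have h2 : 0 ≤ (⟪Γ.act (mom q N 0) v, Γ.act (mom q N 0) v⟫_ℂ).re := inner_self_nonneg (𝕜 := ℂ)
      rw [h] at h2
      exact nonneg_of_mul_nonneg_right h2 (by positivity)
  | succ l ih =>
    have h := congrArg Complex.re (Γ.inner_mom_self l v)
    have h2 : 0 ≤ (⟪Γ.act (mom q N ((l : ℤ) + 1)) v, Γ.act (mom q N ((l : ℤ) + 1)) v⟫_ℂ).re :=
      inner_self_nonneg (𝕜 := ℂ)
    rw [Complex.sub_re] at h
    linarith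

/-- The expectation of `(p·p)_l` is a sum of nonnegative terms, one of them ‖p^l v‖², so p^l v = 0.
Reordering then gives p^l p^{-l} v = 0, which up to a positive factor computes ‖p^{-l} v‖². -/
theorem mom_eq_zero_of_sqMom_eq_zero (hq : 0 < q) {l : ℕ} (hl : par N ≤ l) (hln : l ≤ rk N)
    {v : Γ.dom} (hv : Γ.act (sqMom q N l) v = 0) :
    Γ.act (mom q N l) v = 0 ∧ Γ.act (mom q N (-(l : ℤ))) v = 0 := by
  rcases l with _ | l
  · have hN : ¬ Even N := fun h => by simp [par, h] at hl
    have h := Γ.inner_mom_zero_self hq hN v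
    rw [hv, inner_zero_right, mul_zero, inner_self_eq_zero] at h
    simp [h]
  · have h := congrArg Complex.re (Γ.inner_mom_self l v)
    rw [hv, inner_zero_right, Complex.sub_re, Complex.zero_re] at h
    have h2 := Γ.sqMom_nonneg hq l v
    have h3 : Γ.act (mom q N ((l : ℤ) + 1)) v = 0 := by
      rw [inner_self_eq_ofReal, Complex.ofReal_re] at h
      rw [← norm_eq_zero, ← sq_eq_zero_iff]
      exact le_antisymm (by linarith) (sq_nonneg _)
    push_cast
    refine ⟨h3, ?_⟩
    have h4 : Γ.act (mom q N ((l : ℤ) + 1)) (Γ.act (mom q N (-((l : ℤ) + 1))) v) = 0 := by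
      by_cases hl' : par N ≤ l
      · have h5 := hv
        rw [sqMom_succ, act_add_apply, act_smul_apply, act_mul_apply, h3, map_zero, smul_zero,
          add_zero] at h5
        rw [← act_mul_apply, mom_mul_mom_neg hq hl' hln, act_smul_apply, act_sub_apply,
          act_smul_apply, hv, h5]
        simp
      · rcases par_cases (N := N) with ⟨h5, h6⟩ | ⟨h5, h6⟩
        · omega
        · obtain rfl : l = 0 := by omega
          simp only [Nat.cast_zero, zero_add] at h3 ⊢
          rw [← act_mul_apply, mom_one_comm_even h6 hln, act_mul_apply, h3, map_zero]
    rw [← inner_self_eq_zero (𝕜 := ℂ), inner_mom_left, neg_neg, h4, inner_zero_right, mul_zero]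

/-! ### Joint eigenspaces -/

/-- The joint eigenspace, in the domain, of the `(p·p)_l` with eigenvalues `s l`. -/
def joint (s : ℕ → ℝ) : Submodule ℂ Γ.dom where
  carrier := {v | ∀ l ∈ Finset.Icc (par N) (rk N), Γ.act (sqMom q N l) v = (s l : ℂ) • v}
  add_mem' {u v} hu hv l hl := by rw [map_add, hu l hl, hv l hl, smul_add]
  zero_mem' l _ := by simp
  smul_mem' c v hv l hl := by rw [map_smul, hv l hl, smul_comm]

variable {Γ}

theorem mem_joint {s : ℕ → ℝ} {v : Γ.dom} : v ∈ Γ.joint s ↔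
    ∀ l ∈ Finset.Icc (par N) (rk N), Γ.act (sqMom q N l) v = (s l : ℂ) • v := Iff.rfl

theorem joint_congr {s t : ℕ → ℝ} (h : ∀ l ∈ Finset.Icc (par N) (rk N), s l = t l) :
    Γ.joint s = Γ.joint t := by
  ext v
  simp only [mem_joint]
  exact forall₂_congr fun l hl => by rw [h l hl]

theorem act_mem_joint {x : Alg q N} {t s : ℕ → ℝ}
    (h : ∀ l ∈ Finset.Icc (par N) (rk N), QCommute (t l : ℂ) (sqMom q N l) x) {v : Γ.dom}
    (hv : v ∈ Γ.joint s) : Γ.act x v ∈ Γ.joint (fun l => t l * s l) := by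
  intro l hl
  rw [Γ.act_qcommute (h l hl), hv l hl, map_smul, smul_smul, Complex.ofReal_mul]

theorem mom_mem_joint (hq : 0 < q) (i : ℤ) {s : ℕ → ℝ} {v : Γ.dom} (hv : v ∈ Γ.joint s) :
    Γ.act (mom q N i) v ∈ Γ.joint (fun l => weight q l i * s l) :=
  act_mem_joint (fun l hl => by
    rw [Finset.mem_Icc] at hl; exact qcommute_sqMom_mom hq hl.1 hl.2 i) hv

theorem joint_norm_mom {l : ℕ} (hl : par N ≤ l) (hln : l + 1 ≤ rk N) {s : ℕ → ℝ}
    {v : Γ.dom} (hv : v ∈ Γ.joint s) :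
    ‖Γ.act (mom q N ((l : ℤ) + 1)) v‖ ^ 2 = (s (l + 1) - s l) * ‖v‖ ^ 2 := by
  have h := Γ.inner_mom_self l v
  rw [hv l (by simp; omega), hv (l + 1) (by simp; omega), inner_smul_right, inner_smul_right,
    inner_self_eq_ofReal, inner_self_eq_ofReal] at h
  apply Complex.ofReal_injective
  push_cast
  push_cast at h
  rw [h]
  ring

theorem joint_norm_mom_neg (hq : 0 < q) {l : ℕ} (hl : par N ≤ l) (hln : l + 1 ≤ rk N) {s : ℕ → ℝ}
    {v : Γ.dom} (hv : v ∈ Γ.joint s) :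
    ‖Γ.act (mom q N (-((l : ℤ) + 1))) v‖ ^ 2 =
      q ^ (-(2 * rho N ((l : ℤ) + 1))) * (s (l + 1) - (q ^ 2)⁻¹ * s l) * ‖v‖ ^ 2 := by
  have h := Γ.inner_mom_neg_self hq hl hln v
  rw [hv l (by simp; omega), hv (l + 1) (by simp; omega), inner_smul_right, inner_smul_right,
    inner_self_eq_ofReal, inner_self_eq_ofReal] at h
  apply Complex.ofReal_injective
  unfold qp at h
  push_cast at h ⊢
  rw [h]
  ring

theorem mom_neg_eq_zero_iff (hq : 0 < q) {l : ℕ} (hl : par N ≤ l) (hln : l + 1 ≤ rk N)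
    {s : ℕ → ℝ} {v : Γ.dom} (hv : v ∈ Γ.joint s) (hv0 : v ≠ 0) :
    Γ.act (mom q N (-((l : ℤ) + 1))) v = 0 ↔ s l = q ^ 2 * s (l + 1) := by
  have h := joint_norm_mom_neg hq hl hln hv
  have hc := (Real.rpow_pos_of_pos hq (-(2 * rho N ((l : ℤ) + 1)))).ne'
  have hn := (norm_pos_iff.mpr hv0).ne'
  rw [← norm_eq_zero, ← sq_eq_zero_iff, h]
  have hq2 : q ^ 2 ≠ 0 := by positivity
  simp only [mul_eq_zero, hc, false_or, sq_eq_zero_iff, hn, or_false]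
  constructor
  · intro h; field_simp at h; linarith
  · intro h; rw [h]; field_simp; ring

/-- The norm of p^{-(l+1)} v is nonnegative. -/
theorem joint_le (hq : 0 < q) {l : ℕ} (hl : par N ≤ l) (hln : l + 1 ≤ rk N)
    {s : ℕ → ℝ} {v : Γ.dom} (hv : v ∈ Γ.joint s) (hv0 : v ≠ 0) :
    s l ≤ q ^ 2 * s (l + 1) := by
  have h := joint_norm_mom_neg hq hl hln hv
  have hc := Real.rpow_pos_of_pos hq (-(2 * rho N ((l : ℤ) + 1)))
  have hn := norm_pos_iff.mpr hv0
  have hq2 : 0 < q ^ 2 := by positivity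
  have h1 : 0 ≤ q ^ (-(2 * rho N ((l : ℤ) + 1))) * (s (l + 1) - (q ^ 2)⁻¹ * s l) * ‖v‖ ^ 2 := by
    rw [← h]; positivity
  have h2 := nonneg_of_mul_nonneg_left h1 (by positivity)
  have h3 := nonneg_of_mul_nonneg_right h2 hc
  have : q ^ 2 * (s (l + 1) - (q ^ 2)⁻¹ * s l) = q ^ 2 * s (l + 1) - s l := by field_simp
  nlinarith

theorem joint_nonneg (hq : 0 < q) {l : ℕ} (hl : par N ≤ l) (hln : l ≤ rk N)
    {s : ℕ → ℝ} {v : Γ.dom} (hv : v ∈ Γ.joint s) (hv0 : v ≠ 0) : 0 ≤ s l := by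
  have h := Γ.sqMom_nonneg hq l v
  have hn := norm_pos_iff.mpr hv0
  rw [hv l (by simp; omega), inner_smul_right, inner_self_eq_ofReal, Complex.re_ofReal_mul,
    Complex.ofReal_re] at h
  exact nonneg_of_mul_nonneg_left h (by positivity)

/-- Downward induction from n. If s_l = 0 < s_{l+1}, then p^{±l} kill v, and the relation between
L^{-l,l+1} and p^l makes p^{l+1} v a multiple of w = p^l L^{-l,l+1} v. But w is killed by p^{-l} and
is of the form p^l u, so w = 0, contradicting ‖p^{l+1} v‖² = s_{l+1} ‖v‖² > 0. -/
theorem joint_pos (hq : 0 < q) {l : ℕ} (hl : par N ≤ l) (hln : l ≤ rk N)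
    {s : ℕ → ℝ} {v : Γ.dom} (hv : v ∈ Γ.joint s) (hv0 : v ≠ 0) (hs : 0 < s (rk N)) :
    0 < s l := by
  obtain ⟨k, hk⟩ := Nat.exists_eq_add_of_le hln
  induction k generalizing l with
  | zero => rwa [hk] at hs
  | succ k ih =>
    have hpos := ih (l := l + 1) (by omega) (by omega) (by omega)
    refine lt_of_le_of_ne (joint_nonneg hq hl hln hv hv0) fun h0 => ?_
    have hl0 : Γ.act (sqMom q N l) v = 0 := by
      rw [hv l (by simp; omega), ← h0]; simp
    obtain ⟨h1, h2⟩ := Γ.mom_eq_zero_of_sqMom_eq_zero hq hl hln hl0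
    have hsim : IsSimple N l ((l : ℤ) + 1) := Or.inl (by omega)
    have h3 : Γ.act (mom q N (-(l : ℤ))) (Γ.act (mom q N ((l : ℤ) + 1)) v) = 0 := by
      rw [Γ.act_qcommute (mom_qcommute (by omega) (by omega)), h2, map_zero, smul_zero]
    obtain ⟨c, d, hc, hd, hr⟩ : ∃ c d : ℂ, c ≠ 0 ∧ d ≠ 0 ∧
        gen q N (.raise l ((l : ℤ) + 1)) * mom q N l =
          c • (mom q N l * gen q N (.raise l ((l : ℤ) + 1))) + d • mom q N ((l : ℤ) + 1) := by
      rcases Nat.eq_zero_or_pos l with rfl | h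
      · exact ⟨1, _, one_ne_zero, neg_ne_zero.mpr (inv_ne_zero (Complex.ofReal_ne_zero.mpr hq.ne')), by
          rw [one_smul]; exact raise_mul_mom_zero hq hsim⟩
      · exact ⟨_, _, Complex.ofReal_ne_zero.mpr hq.ne', neg_ne_zero.mpr (qp_ne_zero hq _), raise_mul_mom_top hsim (by omega)⟩
    have h4 := congrArg (fun x => Γ.act x v) hr
    simp only [act_add_apply, act_smul_apply, act_mul_apply, h1, map_zero] at h4
    set w := Γ.act (mom q N l) (Γ.act (gen q N (.raise l ((l : ℤ) + 1))) v)
    have h5 : Γ.act (mom q N (-(l : ℤ))) w = 0 := by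
      have h6 := congrArg (Γ.act (mom q N (-(l : ℤ)))) h4
      rw [map_add, map_smul, map_smul, h3, smul_zero, add_zero, map_zero, eq_comm,
        smul_eq_zero] at h6
      exact h6.resolve_left hc
    have h6 : w = 0 := by
      rw [← inner_self_eq_zero (𝕜 := ℂ), inner_mom_left, h5, inner_zero_right, mul_zero]
    rw [h6, smul_zero, zero_add, eq_comm, smul_eq_zero] at h4
    have h7 := joint_norm_mom hl (by omega) hv
    have hn := norm_pos_iff.mpr hv0
    rw [h4.resolve_left hd, norm_zero, ← h0, sub_zero] at h7
    have : 0 < s (l + 1) * ‖v‖ ^ 2 := by positivity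
    norm_num at h7
    rcases h7 with h7 | h7
    · exact hpos.ne' h7
    · exact hv0 h7

end HilbertRep

/-! ### The lattice of joint eigenvalues -/

/-- The exponent `∑_{k=l}^n (1 + π_k)` of the joint eigenvalues with label `π`. -/
def Label.expo {N : ℕ} (π : Label N) (l : ℕ) : ℤ := ∑ k ∈ Finset.Icc l (rk N), (1 + π.comp k)

theorem eigenval_eq (q M : ℝ) (π : Label N) (l : ℕ) :
    eigenval q M π l = M ^ 2 * q ^ (2 * π.expo l) := by
  rw [eigenval, Label.expo, Finset.mul_sum]

theorem Label.comp_of_lt (π : Label N) {l : ℕ} (hl : par N ≤ l) (hln : l < rk N) :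
    π.comp l = π.1 ⟨l - par N, by omega⟩ := by
  rw [Label.comp, dif_pos]

theorem Label.comp_rk (π : Label N) : π.comp (rk N) = π.2 := by
  rw [Label.comp, dif_neg (lt_irrefl _)]

theorem Label.expo_rk (π : Label N) : π.expo (rk N) = 1 + π.2 := by
  simp [Label.expo, Label.comp_rk]

theorem Label.expo_succ (π : Label N) {l : ℕ} (hln : l < rk N) :
    π.expo l = π.expo (l + 1) + (1 + π.comp l) := by
  have h : Finset.Icc l (rk N) = insert l (Finset.Icc (l + 1) (rk N)) := by
    ext; simp; omega
  rw [Label.expo, Label.expo, h, Finset.sum_insert (by simp), add_comm]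

theorem par_lt_rk (hN : 3 ≤ N) : par N < rk N := by
  unfold rk par
  split_ifs with h
  · obtain ⟨r, rfl⟩ := h; omega
  · omega

theorem Label.expo_injective {π σ : Label N} (hN : par N ≤ rk N)
    (h : ∀ l ∈ Finset.Icc (par N) (rk N), π.expo l = σ.expo l) : π = σ := by
  refine Prod.ext (funext fun i => ?_) ?_
  · have hi := i.2
    have h1 := h (par N + i) (by simp; omega)
    have h2 := h (par N + i + 1) (by simp; omega)
    rw [π.expo_succ (by omega), σ.expo_succ (by omega), h2,
      Label.comp_of_lt _ (by omega) (by omega), Label.comp_of_lt _ (by omega) (by omega)] at h1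
    simpa using h1
  · have h1 := h (rk N) (by simp; omega)
    rw [Label.expo_rk, Label.expo_rk] at h1
    omega

/-- This is the form in which the ladder accumulates exponents: n + 1 - l from the ground space, one
for each factor p^{h+1+i} with l ≤ h + i, and π_n from Λ. -/
theorem Label.expo_eq (π : Label N) {l : ℕ} (hl : par N ≤ l) (hln : l ≤ rk N) :
    π.expo l = ((rk N : ℤ) + 1 - l) +
      ∑ i, (π.1 i : ℤ) * (if l ≤ par N + i then 1 else 0) + π.2 := by
  obtain ⟨k, hk⟩ := Nat.exists_eq_add_of_le hln
  induction k generalizing l with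
  | zero =>
    rw [add_zero] at hk
    subst hk
    rw [Label.expo_rk, Finset.sum_eq_zero]
    · ring
    · intro i _
      rw [if_neg (by have := i.2; omega), mul_zero]
  | succ k ih =>
    rw [Label.expo_succ _ (by omega), ih (l := l + 1) (by omega) (by omega) (by omega),
      Label.comp_of_lt _ hl (by omega)]
    have h : ∀ i : Fin (rk N - par N), (π.1 i : ℤ) * (if l ≤ par N + i then 1 else 0) =
        (π.1 i : ℤ) * (if l + 1 ≤ par N + i then 1 else 0) +
          if i = ⟨l - par N, by omega⟩ then (π.1 i : ℤ) else 0 := by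
      intro i
      have : i = ⟨l - par N, by omega⟩ ↔ l = par N + i := by
        rw [Fin.ext_iff]; simp only; omega
      simp only [this]
      split_ifs <;> omega
    simp_rw [h]
    rw [Finset.sum_add_distrib, Finset.sum_ite_eq' Finset.univ]
    simp
    ring

/-! ### Joint eigenvalues lie on the lattice -/

namespace HilbertRep

variable {H : Type*} [NormedAddCommGroup H] [InnerProductSpace ℂ H] {Γ : HilbertRep q N H}

/-- Ratios of successive joint eigenvalues are even powers of `q`. -/
theorem joint_ratio (hq : 0 < q) (hq1 : q < 1) {l : ℕ} (hl : par N ≤ l) (hln : l + 1 ≤ rk N)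
    {s : ℕ → ℝ} {v : Γ.dom} (hv : v ∈ Γ.joint s) (hv0 : v ≠ 0) (hs : 0 < s (rk N)) :
    ∃ k : ℕ, s l = q ^ (2 * (k + 1)) * s (l + 1) := by
  -- K bounds the number of times p^{-(l+1)} can be applied: each application multiplies s_l by
  -- q^{-2} and fixes s_{l+1} and s_n, and K = 0 contradicts `joint_le`.
  have key : ∀ (K : ℕ) (s : ℕ → ℝ) (v : Γ.dom), v ∈ Γ.joint s → v ≠ 0 → 0 < s (rk N) →
      q ^ (2 * (K + 1)) * s (l + 1) < s l → ∃ k : ℕ, s l = q ^ (2 * (k + 1)) * s (l + 1) := by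
    intro K
    induction K with
    | zero =>
      intro s v hv hv0 hs h
      have := joint_le hq hl hln hv hv0
      simp at h
      linarith
    | succ K ih =>
      intro s v hv hv0 hs h
      by_cases h0 : Γ.act (mom q N (-((l : ℤ) + 1))) v = 0
      · exact ⟨0, by simpa using (mom_neg_eq_zero_iff hq hl hln hv hv0).mp h0⟩
      · have w1 : weight q l (-((l : ℤ) + 1)) = (q ^ 2)⁻¹ := by
          rw [weight, if_neg (by omega), if_pos (by omega)]
        have w2 : ∀ j : ℕ, l < j → weight q j (-((l : ℤ) + 1)) = 1 := fun j hj => by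
          rw [weight, if_neg (by omega), if_neg (by omega)]
        have hq2 : 0 < q ^ 2 := by positivity
        obtain ⟨k, hk⟩ := ih _ _ (mom_mem_joint hq (-((l : ℤ) + 1)) hv) h0
          (by simpa only [w2 (rk N) (by omega), one_mul] using hs) (by
            simp only [w1, w2 _ (Nat.lt_succ_self l), one_mul]
            rw [lt_inv_mul_iff₀ hq2]
            refine lt_of_eq_of_lt ?_ h
            ring)
        simp only [w1, w2 _ (Nat.lt_succ_self l), one_mul] at hk
        rw [inv_mul_eq_iff_eq_mul₀ hq2.ne'] at hk
        exact ⟨k + 1, by rw [hk]; ring⟩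
  have h0 := joint_pos hq hl (by omega) hv hv0 hs
  have h1 := joint_pos hq (l := l + 1) (by omega) hln hv hv0 hs
  obtain ⟨K, hK⟩ := exists_pow_lt_of_lt_one (div_pos h0 h1) hq1
  refine key K s v hv hv0 hs ?_
  rw [lt_div_iff₀ h1] at hK
  refine lt_of_le_of_lt (mul_le_mul_of_nonneg_right ?_ h1.le) hK
  exact pow_le_pow_of_le_one hq.le hq1.le (by omega)

theorem exists_label (hq : 0 < q) (hq1 : q < 1) {M : ℝ} (hM : 0 < M) {s : ℕ → ℝ} {v : Γ.dom}
    (hv : v ∈ Γ.joint s) (hv0 : v ≠ 0) {z : ℤ} (hs : s (rk N) = M ^ 2 * q ^ (2 * z)) :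
    ∃ π : Label N, ∀ l ∈ Finset.Icc (par N) (rk N), s l = eigenval q M π l := by
  have hs0 : 0 < s (rk N) := by rw [hs]; positivity
  have hr : ∀ l : ℕ, ∃ k : ℕ, par N ≤ l → l + 1 ≤ rk N →
      s l = q ^ (2 * (k + 1)) * s (l + 1) := by
    intro l
    by_cases h : par N ≤ l ∧ l + 1 ≤ rk N
    · obtain ⟨k, hk⟩ := joint_ratio hq hq1 h.1 h.2 hv hv0 hs0
      exact ⟨k, fun _ _ => hk⟩
    · exact ⟨0, fun h1 h2 => absurd ⟨h1, h2⟩ h⟩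
  choose k hk using hr
  -- The last component is z - 1 because the exponent at l = n is 1 + π_n.
  refine ⟨(fun i => k (par N + i), z - 1), fun l hl => ?_⟩
  rw [Finset.mem_Icc] at hl
  obtain ⟨hl, hln⟩ := hl
  obtain ⟨d, hd⟩ := Nat.exists_eq_add_of_le hln
  rw [eigenval_eq]
  induction d generalizing l with
  | zero =>
    rw [add_zero] at hd
    subst hd
    rw [Label.expo_rk, hs, add_sub_cancel]
  | succ d ih =>
    rw [Label.expo_succ _ (by omega), Label.comp_of_lt _ hl (by omega), hk l hl (by omega),
      ih (l + 1) (by omega) (by omega) (by omega), mul_add 2 (Label.expo _ _),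
      zpow_add₀ hq.ne']
    simp only [show par N + (l - par N) = l by omega]
    have : q ^ (2 * (1 + (k l : ℤ))) = q ^ (2 * (k l + 1)) := by
      rw [← zpow_natCast]; congr 1; push_cast; ring
    rw [this]
    ring

/-! ### Bijections between joint eigenspaces -/

/-- The values `M² q^{2 e_l}`. -/
noncomputable def lattice (q M : ℝ) (e : ℕ → ℤ) (l : ℕ) : ℝ := M ^ 2 * q ^ (2 * e l)

/-- The element `x` maps the joint eigenspace with exponents `e` bijectively onto the one with
exponents `e'`. -/
def Shifts (Γ : HilbertRep q N H) (M : ℝ) (x : Alg q N) (e e' : ℕ → ℤ) : Prop :=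
  (Γ.joint (lattice q M e)).map (Γ.act x) = Γ.joint (lattice q M e') ∧
    ∀ v ∈ Γ.joint (lattice q M e), Γ.act x v = 0 → v = 0

namespace Shifts

variable {M : ℝ} {x y : Alg q N} {e e' e'' : ℕ → ℤ}

theorem one : Γ.Shifts M 1 e e := by
  refine ⟨?_, fun v _ h => by rwa [act_one_apply] at h⟩
  rw [map_one]
  exact Submodule.map_id _

theorem mul (hx : Γ.Shifts M x e e') (hy : Γ.Shifts M y e' e'') : Γ.Shifts M (y * x) e e'' := by
  refine ⟨?_, fun v hv h => hx.2 v hv (hy.2 _ ?_ (by rwa [← act_mul_apply]))⟩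
  · rw [map_mul, Module.End.mul_eq_comp, Submodule.map_comp, hx.1, hy.1]
  · rw [← hx.1]; exact Submodule.mem_map_of_mem hv

theorem of_inverse {c : ℂ} (hc : c ≠ 0)
    (hx : ∀ v ∈ Γ.joint (lattice q M e), Γ.act x v ∈ Γ.joint (lattice q M e'))
    (hy : ∀ v ∈ Γ.joint (lattice q M e'), Γ.act y v ∈ Γ.joint (lattice q M e))
    (hyx : ∀ v ∈ Γ.joint (lattice q M e), Γ.act y (Γ.act x v) = c • v)
    (hxy : ∀ v ∈ Γ.joint (lattice q M e'), Γ.act x (Γ.act y v) = c • v) :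
    Γ.Shifts M x e e' := by
  refine ⟨le_antisymm ?_ fun v hv => ?_, fun v hv h => ?_⟩
  · rintro _ ⟨v, hv, rfl⟩
    exact hx v hv
  · refine ⟨c⁻¹ • Γ.act y v, Submodule.smul_mem _ _ (hy v hv), ?_⟩
    rw [map_smul, hxy v hv, smul_smul, inv_mul_cancel₀ hc, one_smul]
  · have := hyx v hv
    rw [h, map_zero, eq_comm, smul_eq_zero] at this
    exact this.resolve_left hc

theorem congr (h : Γ.Shifts M x e e') (he : ∀ l ∈ Finset.Icc (par N) (rk N), e' l = e'' l) :
    Γ.Shifts M x e e'' := by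
  refine ⟨h.1.trans (joint_congr fun l hl => ?_), h.2⟩
  rw [lattice, lattice, he l hl]

end Shifts

theorem act_mem_lattice (hq : 0 < q) {M : ℝ} {x : Alg q N} {t e : ℕ → ℤ}
    (h : ∀ l ∈ Finset.Icc (par N) (rk N), QCommute ((q ^ (2 * t l) : ℝ) : ℂ) (sqMom q N l) x)
    {v : Γ.dom} (hv : v ∈ Γ.joint (lattice q M e)) :
    Γ.act x v ∈ Γ.joint (lattice q M (fun l => e l + t l)) := by
  have := act_mem_joint (t := fun l => q ^ (2 * t l)) h hv
  convert this using 2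
  funext l
  rw [lattice, lattice, mul_add, zpow_add₀ hq.ne']
  ring

/-- The exponent of `weight`. -/
def weightExp (l : ℕ) (i : ℤ) : ℤ := if (l : ℤ) < i then 1 else if (l : ℤ) < -i then -1 else 0

theorem weight_eq (q : ℝ) (l : ℕ) (i : ℤ) : weight q l i = q ^ (2 * weightExp l i) := by
  unfold weight weightExp
  split_ifs
  · norm_cast
  · rw [mul_neg, zpow_neg]; norm_cast
  · simp

theorem mom_mem_lattice (hq : 0 < q) {M : ℝ} {e : ℕ → ℤ} (i : ℤ)
    {v : Γ.dom} (hv : v ∈ Γ.joint (lattice q M e)) :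
    Γ.act (mom q N i) v ∈ Γ.joint (lattice q M (fun l => e l + weightExp l i)) :=
  act_mem_lattice hq (fun l hl => by
    rw [Finset.mem_Icc] at hl; rw [← weight_eq]; exact qcommute_sqMom_mom hq hl.1 hl.2 i) hv

/-- The condition on e means s_l < s_{l+1}, so p^{-(l+1)} p^{l+1} is a nonzero scalar on the source.
On the target s_l has gained q², which cancels the q^{-2} of the opposite product and gives the same
scalar there. -/
theorem shifts_mom (hq : 0 < q) (hq1 : q < 1) {M : ℝ} (hM : 0 < M) {e : ℕ → ℤ} {l : ℕ}
    (hl : par N ≤ l) (hln : l + 1 ≤ rk N) (he : e (l + 1) < e l) :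
    Γ.Shifts M (mom q N ((l : ℤ) + 1)) e (fun j => e j + if j ≤ l then 1 else 0) := by
  have w1 : ∀ j : ℕ, weightExp j ((l : ℤ) + 1) = if j ≤ l then 1 else 0 := fun j => by
    unfold weightExp; split_ifs <;> omega
  have w2 : ∀ j : ℕ, weightExp j (-((l : ℤ) + 1)) = - if j ≤ l then 1 else 0 := fun j => by
    unfold weightExp; split_ifs <;> omega
  have hlt : lattice q M e l < lattice q M e (l + 1) := by
    unfold lattice
    have := zpow_lt_zpow_right_of_lt_one₀ hq hq1 (show 2 * e (l + 1) < 2 * e l by omega)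
    have hM2 : 0 < M ^ 2 := by positivity
    nlinarith
  have hc : (qp q (rho N ((l : ℤ) + 1)))⁻¹ *
      ((lattice q M e (l + 1) : ℂ) - (lattice q M e l : ℂ)) ≠ 0 := by
    refine mul_ne_zero (inv_ne_zero (qp_ne_zero hq _)) ?_
    rw [← Complex.ofReal_sub]
    exact_mod_cast (sub_pos.mpr hlt).ne'
  refine Shifts.of_inverse (y := mom q N (-((l : ℤ) + 1))) hc (fun v hv => ?_) (fun v hv => ?_)
    (fun v hv => ?_) (fun v hv => ?_)
  · have := mom_mem_lattice hq ((l : ℤ) + 1) hv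
    simpa only [w1] using this
  · have := mom_mem_lattice hq (-((l : ℤ) + 1)) hv
    simpa only [w2, add_neg_cancel_right] using this
  · rw [← act_mul_apply, mom_neg_mul_mom hq, act_smul_apply, act_sub_apply,
      hv _ (by simp; omega), hv _ (by simp; omega), ← sub_smul, smul_smul]
  · rw [← act_mul_apply, mom_mul_mom_neg hq hl hln, act_smul_apply, act_sub_apply, act_smul_apply,
      hv _ (by simp; omega), hv _ (by simp; omega), smul_smul, ← sub_smul, smul_smul]
    congr 3
    · simp [lattice]
    · rw [qp_neg hq]
      simp only [lattice, le_refl, if_true, mul_add, zpow_add₀ hq.ne', qp]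
      have hq' : (q : ℂ) ≠ 0 := by exact_mod_cast hq.ne'
      norm_num
      field_simp

theorem shifts_mom_pow (hq : 0 < q) (hq1 : q < 1) {M : ℝ} (hM : 0 < M) {e : ℕ → ℤ} {l : ℕ}
    (hl : par N ≤ l) (hln : l + 1 ≤ rk N) (he : e (l + 1) < e l) (r : ℕ) :
    Γ.Shifts M (mom q N ((l : ℤ) + 1) ^ r) e
      (fun j => e j + (r : ℤ) * if j ≤ l then 1 else 0) := by
  induction r with
  | zero => simpa using Shifts.one
  | succ r ih =>
    rw [pow_succ']
    have := ih.mul (shifts_mom hq hq1 hM hl hln (by simp; omega))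
    refine this.congr fun j _ => ?_
    push_cast
    ring

theorem shifts_mom_prod (hq : 0 < q) (hq1 : q < 1) {M : ℝ} (hM : 0 < M) {e : ℕ → ℤ}
    (he : ∀ l, par N ≤ l → l + 1 ≤ rk N → e (l + 1) < e l) {d : ℕ} (hd : par N + d ≤ rk N)
    (r : Fin d → ℕ) :
    Γ.Shifts M (List.ofFn fun j : Fin d =>
        gen q N (.p ((par N : ℤ) + 1 + (j : ℤ))) ^ r j).reverse.prod e
      (fun l => e l + ∑ i, (r i : ℤ) * if l ≤ par N + i then 1 else 0) := by
  induction d with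
  | zero => simpa using Shifts.one
  | succ d ih =>
    rw [List.ofFn_succ', List.concat_eq_append, List.reverse_append, List.reverse_singleton,
      List.singleton_append, List.prod_cons]
    have h1 := ih (by omega) (fun i => r i.castSucc)
    have h2 := h1.mul (shifts_mom_pow hq hq1 hM (l := par N + d) (by omega) (by omega) ?_
      (r (Fin.last d)))
    · have h3 : ((par N + d : ℕ) : ℤ) + 1 = (par N : ℤ) + 1 + ((Fin.last d : Fin (d + 1)) : ℤ) := by
        simp; ring
      rw [h3] at h2
      refine h2.congr fun l _ => ?_
      rw [Fin.sum_univ_castSucc]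
      simp [add_assoc]
    -- The factors already applied add at least as much to the exponent at level h + d as at h + d +
    -- 1, so strict decrease persists.
    · refine add_lt_add_of_lt_of_le (he _ (by omega) (by omega)) (Finset.sum_le_sum fun i _ => ?_)
      refine mul_le_mul_of_nonneg_left ?_ (by positivity)
      split_ifs <;> omega

theorem shifts_lamPow (hq : 0 < q) {M : ℝ} {e : ℕ → ℤ} (z : ℤ) :
    Γ.Shifts M (lamPow q N z) e (fun l => e l + z) := by
  have h1 : ∀ (e : ℕ → ℤ), ∀ v ∈ Γ.joint (lattice q M e), Γ.act (gen q N .lam) v ∈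
      Γ.joint (lattice q M (fun l => e l + 1)) := fun e v hv =>
    act_mem_lattice hq (t := fun _ => 1) (fun l _ => by
      simpa using qcommute_sqMom_lam hq l) hv
  have h2 : ∀ (e : ℕ → ℤ), ∀ v ∈ Γ.joint (lattice q M e), Γ.act (gen q N .lamInv) v ∈
      Γ.joint (lattice q M (fun l => e l + -1)) := fun e v hv =>
    act_mem_lattice hq (t := fun _ => -1) (fun l _ => by
      simpa using qcommute_sqMom_lamInv hq l) hv
  have h3 : ∀ v, Γ.act (gen q N .lam) (Γ.act (gen q N .lamInv) v) = (1 : ℂ) • v := fun v => by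
    rw [← act_mul_apply, lam_mul_lamInv, act_one_apply, one_smul]
  have h4 : ∀ v, Γ.act (gen q N .lamInv) (Γ.act (gen q N .lam) v) = (1 : ℂ) • v := fun v => by
    rw [← act_mul_apply, lamInv_mul_lam, act_one_apply, one_smul]
  have h5 : ∀ e, Γ.Shifts M (gen q N .lam) e (fun l => e l + 1) := fun e =>
    .of_inverse one_ne_zero (h1 e) (fun v hv => by simpa using h2 _ v hv) (fun v _ => h4 v)
      (fun v _ => h3 v)
  have h6 : ∀ e, Γ.Shifts M (gen q N .lamInv) e (fun l => e l + -1) := fun e =>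
    .of_inverse one_ne_zero (h2 e) (fun v hv => by simpa using h1 _ v hv) (fun v _ => h3 v)
      (fun v _ => h4 v)
  rcases z with r | r
  · change Γ.Shifts M (gen q N .lam ^ r) e _
    induction r with
    | zero => simpa using Shifts.one
    | succ r ih =>
      rw [pow_succ']
      refine (ih.mul (h5 _)).congr fun l _ => ?_
      simp; ring
  · change Γ.Shifts M (gen q N .lamInv ^ (r + 1)) e _
    induction r with
    | zero => simpa using h6 e
    | succ r ih =>
      rw [pow_succ']
      refine (ih.mul (h6 _)).congr fun l _ => ?_
      rw [Int.negSucc_eq, Int.negSucc_eq]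
      push_cast; ring

/-- Starting from s_n = M² q², the equations p^{-(l+1)} v = 0 force s_l = q² s_{l+1} level by level.
These are the exponents of the zero label. -/
theorem ground_eq (hq : 0 < q) (hN : par N < rk N) (M : ℝ) :
    Γ.ground M = Γ.joint (lattice q M fun l => (rk N : ℤ) + 1 - l) := by
  ext v
  simp only [ground, Submodule.mem_inf, LinearMap.mem_ker, Submodule.mem_iInf, LinearMap.sub_apply,
    LinearMap.smul_apply, Module.End.one_apply, sub_eq_zero]
  constructor
  · rintro ⟨h1, h2⟩ l hl
    rw [Finset.mem_Icc] at hl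
    obtain ⟨hl, hln⟩ := hl
    obtain ⟨d, hd⟩ := Nat.exists_eq_add_of_le hln
    induction d generalizing l with
    | zero =>
      rw [add_zero] at hd
      subst hd
      rw [h1, lattice]
      congr 2
      simp
    | succ d ih =>
      have h3 := ih (l + 1) (by omega) (by omega) (by omega)
      have h4 := h2 (l + 1) (by simp; omega)
      push_cast at h4
      have h5 := mom_mul_mom_neg (q := q) hq hl (by omega)
      have h6 := congrArg (fun x => Γ.act x v) h5
      simp only [act_mul_apply, h4, map_zero, act_smul_apply, act_sub_apply, h3] at h6
      rw [eq_comm, smul_eq_zero, or_iff_right (inv_ne_zero (qp_ne_zero hq _)), sub_eq_zero,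
        qp_neg hq, eq_inv_smul_iff₀ (qp_ne_zero hq _)] at h6
      rw [← h6, smul_smul]
      congr 1
      unfold lattice qp
      rw [show 2 * ((rk N : ℤ) + 1 - (l : ℤ)) = 2 * ((rk N : ℤ) + 1 - ((l + 1 : ℕ) : ℤ)) + 2 by
        push_cast; ring, zpow_add₀ hq.ne']
      push_cast
      norm_num
      ring
  · intro hv
    constructor
    · rw [hv _ (by simp; omega), lattice]
      congr 2
      simp
    · intro l hl
      rw [Finset.mem_Ioc] at hl
      obtain ⟨l, rfl⟩ := Nat.exists_eq_succ_of_ne_zero (show l ≠ 0 by omega)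
      by_cases hv0 : v = 0
      · rw [hv0, map_zero]
      have := (mom_neg_eq_zero_iff hq (l := l) (by omega) (by omega) hv hv0).mpr ?_
      · simpa using this
      · unfold lattice
        rw [show 2 * ((rk N : ℤ) + 1 - (l : ℤ)) = 2 * ((rk N : ℤ) + 1 - ((l + 1 : ℕ) : ℤ)) + 2 by
          push_cast; ring, zpow_add₀ hq.ne', zpow_ofNat]
        ring

theorem shifts_ladder (hq : 0 < q) (hq1 : q < 1) (hN : par N < rk N) {M : ℝ} (hM : 0 < M)
    (π : Label N) : Γ.Shifts M (ladder q π) (fun l => (rk N : ℤ) + 1 - l) π.expo := by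
  have h1 := shifts_mom_prod (Γ := Γ) hq hq1 hM (e := fun l => (rk N : ℤ) + 1 - l)
    (fun l _ _ => by simp) (d := rk N - par N) (by omega) π.1
  refine (h1.mul (shifts_lamPow hq π.2)).congr fun l hl => ?_
  rw [Finset.mem_Icc] at hl
  rw [Label.expo_eq π hl.1 hl.2]

theorem joint_lattice_expo (M : ℝ) (π : Label N) :
    Γ.joint (lattice q M π.expo) = Γ.joint (eigenval q M π) :=
  joint_congr fun l _ => (eigenval_eq q M π l).symm

theorem domSector_eq (hq : 0 < q) (hq1 : q < 1) (hN : par N < rk N) {M : ℝ} (hM : 0 < M)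
    (π : Label N) : Γ.domSector M π = Γ.joint (eigenval q M π) := by
  rw [domSector, ground_eq hq hN, (shifts_ladder hq hq1 hN hM π).1, joint_lattice_expo]

/-- The eigenvalues in a joint eigenstate are real. -/
theorem exists_joint_of_hasEigenstate (hq : 0 < q) (hN : par N < rk N) {M : ℝ}
    (h : Γ.HasEigenstate M) :
    ∃ (s : ℕ → ℝ) (v : Γ.dom), v ∈ Γ.joint s ∧ v ≠ 0 ∧ s (rk N) = M ^ 2 := by
  obtain ⟨ψ, h0, h1, h2⟩ := h
  choose! a ha using h2
  have hreal : ∀ l ∈ Finset.Icc (par N) (rk N), a l = ((a l).re : ℂ) := fun l hl => by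
    have h3 := Γ.inner_sqMom_left hq l ψ ψ
    rw [ha l hl, inner_smul_left, inner_smul_right] at h3
    exact (Complex.conj_eq_iff_re.mp
      (mul_right_cancel₀ (inner_self_ne_zero.mpr h0) h3)).symm
  have hm : rk N ∈ Finset.Icc (par N) (rk N) := by simp; omega
  refine ⟨fun l => (a l).re, ψ, fun l hl => by rw [← hreal l hl]; exact ha l hl, h0, ?_⟩
  have h3 := (ha _ hm).symm.trans h1
  have h4 := smul_left_injective ℂ h0 h3
  change (a (rk N)).re = _
  rw [h4, Complex.ofReal_re]

/-- The given eigenvector lies in some lattice eigenspace, which is the image of the ground space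
under a ladder monomial. Hence the ground space is nonzero, and every other monomial is injective on
it. -/
theorem domSector_ne_bot (hq : 0 < q) (hq1 : q < 1) (hN : par N < rk N) {M : ℝ} (hM : 0 < M)
    (h : Γ.HasEigenstate M) (π : Label N) : Γ.domSector M π ≠ ⊥ := by
  obtain ⟨s, v, hv, hv0, hs⟩ := exists_joint_of_hasEigenstate hq hN h
  obtain ⟨σ, hσ⟩ := exists_label hq hq1 hM hv hv0 (z := 0) (by simpa using hs)
  rw [joint_congr hσ, ← joint_lattice_expo, ← (shifts_ladder hq hq1 hN hM σ).1] at hv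
  obtain ⟨w, hw, rfl⟩ := hv
  have hw0 : w ≠ 0 := by rintro rfl; exact hv0 (map_zero _)
  intro hbot
  have hmem : Γ.act (ladder q π) w ∈ Γ.domSector M π := by
    rw [domSector, ground_eq hq hN]
    exact Submodule.mem_map_of_mem hw
  rw [hbot, Submodule.mem_bot] at hmem
  exact hw0 ((shifts_ladder hq hq1 hN hM π).2 w hw hmem)

/-! ### The sum of all joint eigenspaces is invariant -/

variable (Γ) in
/-- The algebraic sum of the joint eigenspaces. -/
noncomputable def total (M : ℝ) : Submodule ℂ Γ.dom :=
  ⨆ π : Label N, Γ.joint (eigenval q M π)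

/-- By `exists_label`, a nonzero joint eigenvector with arbitrary integer exponents has an
admissible label automatically, so invariance can be checked without tracking labels. -/
theorem mem_total (hq : 0 < q) (hq1 : q < 1) {M : ℝ} (hM : 0 < M) {e : ℕ → ℤ} {v : Γ.dom}
    (hv : v ∈ Γ.joint (lattice q M e)) : v ∈ Γ.total M := by
  by_cases hv0 : v = 0
  · rw [hv0]; exact Submodule.zero_mem _
  · obtain ⟨π, hπ⟩ := exists_label hq hq1 hM hv hv0 rfl
    rw [joint_congr hπ] at hv
    exact Submodule.mem_iSup_of_mem π hv

/-- When x fails to commute only with `(p·p)_l`, and its defect w v has a different value of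
`(p·p)_l` (this is `hfl`), a suitable multiple of w v corrects x v to a joint eigenvector with the
exponents of v. -/
theorem act_mem_total_of_commutator (hq : 0 < q) (hq1 : q < 1) {M : ℝ} (hM : 0 < M) {x w : Alg q N}
    {c : ℂ} {l : ℕ} {e f : ℕ → ℤ} (hl : l ∈ Finset.Icc (par N) (rk N))
    (hx : ∀ j ∈ Finset.Icc (par N) (rk N), j ≠ l → QCommute 1 x (sqMom q N j))
    (hxl : x * sqMom q N l = sqMom q N l * x + c • w)
    (hf : ∀ j ∈ Finset.Icc (par N) (rk N), j ≠ l → f j = 0) (hfl : f l ≠ 0)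
    {v : Γ.dom} (hv : v ∈ Γ.joint (lattice q M e))
    (hw : Γ.act w v ∈ Γ.joint (lattice q M fun l => e l + f l)) : Γ.act x v ∈ Γ.total M := by
  have ht : q ^ (2 * f l) - 1 ≠ 0 := by
    rw [sub_ne_zero, ← zpow_zero q]
    intro h
    have := zpow_right_injective₀ hq hq1.ne h
    omega
  have hs : lattice q M e l ≠ 0 := by unfold lattice; positivity
  have ht' : ((q ^ (2 * f l) - 1 : ℝ) : ℂ) ≠ 0 := by exact_mod_cast ht
  have hs' : (lattice q M e l : ℂ) ≠ 0 := by exact_mod_cast hs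
  -- With E the value of `(p·p)_l` on v, the condition on the corrected vector is b E (q^{2 f_l} -
  -- 1) = c.
  set b : ℂ := c / (lattice q M e l * ((q ^ (2 * f l) - 1 : ℝ) : ℂ)) with hb
  have hu : Γ.act x v + b • Γ.act w v ∈ Γ.joint (lattice q M e) := by
    intro j hj
    by_cases hjl : j = l
    · subst hjl
      have h1 := Γ.act_mul_apply x (sqMom q N j) v
      rw [hxl, hv j hj, map_smul, act_add_apply, act_smul_apply, act_mul_apply] at h1
      rw [map_add, map_smul, hw j hj, eq_sub_of_add_eq h1]
      have h2 : (lattice q M (fun l => e l + f l) j : ℂ) =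
          lattice q M e j + lattice q M e j * ((q ^ (2 * f j) - 1 : ℝ) : ℂ) := by
        unfold lattice
        rw [mul_add, zpow_add₀ hq.ne']
        push_cast
        ring
      rw [h2, smul_smul, mul_add b, add_smul, show b * ((lattice q M e j : ℂ) *
        ((q ^ (2 * f j) - 1 : ℝ) : ℂ)) = c by rw [hb]; field_simp, smul_add, smul_smul,
        mul_comm b]
      abel
    · have h1 := Γ.act_qcommute (hx j hj hjl) v
      rw [hv j hj, map_smul, one_smul] at h1
      rw [map_add, map_smul, hw j hj, ← h1, smul_add, smul_comm b]
      simp only [lattice, hf j hj hjl, add_zero]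
  have := Submodule.sub_mem _ (mem_total hq hq1 hM hu)
    (Submodule.smul_mem _ b (mem_total hq hq1 hM hw))
  simpa using this

theorem gen_mem_total (hq : 0 < q) (hq1 : q < 1) {M : ℝ} (hM : 0 < M) (g : Gen) {e : ℕ → ℤ}
    {v : Γ.dom} (hv : v ∈ Γ.joint (lattice q M e)) : Γ.act (gen q N g) v ∈ Γ.total M := by
  rcases g with i | i | ⟨a, m⟩ | ⟨a, m⟩ | _ | _
  · exact mem_total hq hq1 hM (mom_mem_lattice hq i hv)
  · exact mem_total hq hq1 hM (act_mem_lattice hq (t := fun _ => 0)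
      (fun l _ => by simpa using qcommute_sqMom_k hq l i) hv)
  · by_cases h : IsSimple N a m
    · obtain ⟨l, rfl, hl, hln, ha⟩ := h.exists_nat
      have ha' : a = l ∨ (a = -1 ∧ l = 1) := by tauto
      refine act_mem_total_of_commutator hq hq1 hM (l := l)
        (f := fun j => weightExp j ((l : ℤ) + 1) + weightExp j (-a)) (by simp; omega)
        (fun j hj hjl => raise_qcommute_sqMom hq h ha (Finset.mem_Icc.mp hj).1 hjl)
        (raise_mul_sqMom hq h ha) (fun j hj hjl => ?_) ?_ hv ?_
      · have hpar := (Finset.mem_Icc.mp hj).1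
        have hpar' : par N = 1 ∨ a = l := by
          rcases ha with h | h
          · exact Or.inr h
          · exact Or.inl (by simp [par, h.1])
        unfold weightExp
        split_ifs <;> omega
      · unfold weightExp
        split_ifs <;> omega
      · rw [act_mul_apply]
        simpa only [add_assoc] using mom_mem_lattice hq (-a) (mom_mem_lattice hq ((l : ℤ) + 1) hv)
    · have : gen q N (.raise a m) = 0 :=
        (toAlg_rel (Rel.raise_triv (q := q) a m h)).trans (map_zero _)
      rw [this, act_zero_apply]
      exact Submodule.zero_mem _
  · by_cases h : IsSimple N a m
    · obtain ⟨l, rfl, hl, hln, ha⟩ := h.exists_nat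
      have ha' : a = l ∨ (a = -1 ∧ l = 1) := by tauto
      refine act_mem_total_of_commutator hq hq1 hM (l := l)
        (f := fun j => weightExp j a + weightExp j (-((l : ℤ) + 1))) (by simp; omega)
        (fun j hj hjl => lower_qcommute_sqMom hq h ha (Finset.mem_Icc.mp hj).1 hjl)
        (lower_mul_sqMom hq h ha) (fun j hj hjl => ?_) ?_ hv ?_
      · have hpar := (Finset.mem_Icc.mp hj).1
        have hpar' : par N = 1 ∨ a = l := by
          rcases ha with h | h
          · exact Or.inr h
          · exact Or.inl (by simp [par, h.1])
        unfold weightExp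
        split_ifs <;> omega
      · unfold weightExp
        split_ifs <;> omega
      · rw [act_mul_apply]
        simpa only [add_assoc] using mom_mem_lattice hq (-((l : ℤ) + 1)) (mom_mem_lattice hq a hv)
    · have : gen q N (.lower a m) = 0 :=
        (toAlg_rel (Rel.lower_triv (q := q) a m h)).trans (map_zero _)
      rw [this, act_zero_apply]
      exact Submodule.zero_mem _
  · exact mem_total hq hq1 hM (act_mem_lattice hq (t := fun _ => 1)
      (fun l _ => by simpa using qcommute_sqMom_lam hq l) hv)
  · exact mem_total hq hq1 hM (act_mem_lattice hq (t := fun _ => -1)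
      (fun l _ => by simpa using qcommute_sqMom_lamInv hq l) hv)

theorem total_invariant (hq : 0 < q) (hq1 : q < 1) {M : ℝ} (hM : 0 < M) (a : Alg q N) :
    ∀ v ∈ Γ.total M, Γ.act a v ∈ Γ.total M := by
  obtain ⟨a, rfl⟩ := RingQuot.mkAlgHom_surjective ℂ (Rel q N) a
  change ∀ v ∈ Γ.total M, Γ.act (toAlg q N a) v ∈ Γ.total M
  induction a using FreeAlgebra.induction with
  | grade0 r =>
    intro v hv
    rw [AlgHom.commutes, AlgHom.commutes]
    exact Submodule.smul_mem _ r hv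
  | grade1 g =>
    intro v hv
    refine Submodule.iSup_induction _ (motive := fun v => Γ.act (gen q N g) v ∈ Γ.total M) hv
      (fun π v hv => ?_) ?_ fun v w h1 h2 => ?_
    · rw [← joint_lattice_expo] at hv
      exact gen_mem_total hq hq1 hM g hv
    · rw [map_zero]; exact Submodule.zero_mem _
    · rw [map_add]; exact Submodule.add_mem _ h1 h2
  | mul a b iha ihb =>
    intro v hv
    rw [map_mul, act_mul_apply]
    exact iha _ (ihb v hv)
  | add a b iha ihb =>
    intro v hv
    rw [map_add, act_add_apply]
    exact Submodule.add_mem _ (iha v hv) (ihb v hv)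

theorem dense_total (hq : 0 < q) (hq1 : q < 1) (hN : par N < rk N) (hΓ : Γ.IsIrreducible) {M : ℝ}
    (hM : 0 < M) (h : Γ.HasEigenstate M) :
    Dense ((Γ.total M).map Γ.dom.subtype : Set H) := by
  refine (hΓ.2 _ (total_invariant hq hq1 hM)).resolve_left fun hbot => ?_
  refine domSector_ne_bot hq hq1 hN hM h 0 ?_
  rw [domSector_eq hq hq1 hN hM, eq_bot_iff, ← hbot]
  exact le_iSup (fun π : Label N => Γ.joint (eigenval q M π)) 0

/-! ### Closed observables -/

/-- Symmetry against a fixed domain vector is a closed condition on the graph. -/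
theorem inner_of_mem_observable (hq : 0 < q) {l : ℕ} {p : H × H} (hp : p ∈ Γ.observable l)
    (u : Γ.dom) : ⟪p.2, (u : H)⟫_ℂ = ⟪p.1, (Γ.act (sqMom q N l) u : H)⟫_ℂ := by
  have hc : IsClosed {p : H × H | ⟪p.2, (u : H)⟫_ℂ = ⟪p.1, (Γ.act (sqMom q N l) u : H)⟫_ℂ} :=
    isClosed_eq (by fun_prop) (by fun_prop)
  refine closure_minimal ?_ hc hp
  rintro _ ⟨v, rfl⟩
  exact Γ.inner_sqMom_left hq l v u

/-- The usual orthogonality of eigenvectors, with x an eigenvector of the closure only. The number a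
is not assumed real, since the eigenvalue of u is. -/
theorem inner_eq_zero_of_mem_observable (hq : 0 < q) {l : ℕ} (hl : l ∈ Finset.Icc (par N) (rk N))
    {x : H} {a : ℂ} (hx : (x, a • x) ∈ Γ.observable l) {s : ℕ → ℝ} {u : Γ.dom}
    (hu : u ∈ Γ.joint s) (ha : a ≠ s l) : ⟪x, (u : H)⟫_ℂ = 0 := by
  have h := inner_of_mem_observable hq hx u
  rw [hu l hl, Submodule.coe_smul, inner_smul_left, inner_smul_right] at h
  by_contra h0
  have h1 := mul_right_cancel₀ h0 h
  exact ha (by rw [← Complex.conj_conj a, h1, Complex.conj_ofReal])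

theorem mem_observable_of_mem_closure {l : ℕ} {c : ℂ} {V : Submodule ℂ Γ.dom}
    (hV : ∀ v ∈ V, Γ.act (sqMom q N l) v = c • v) {x : H}
    (hx : x ∈ (V.map Γ.dom.subtype).topologicalClosure) : (x, c • x) ∈ Γ.observable l := by
  have hc : IsClosed {x : H | (x, c • x) ∈ Γ.observable l} :=
    (Submodule.isClosed_topologicalClosure _).preimage (by fun_prop)
  refine closure_minimal ?_ hc hx
  rintro _ ⟨v, hv, rfl⟩
  refine Submodule.le_topologicalClosure _ ⟨v, ?_⟩
  simp [hV v hv]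

theorem eigenval_injective (hq : 0 < q) (hq1 : q < 1) (hN : par N < rk N) {M : ℝ} (hM : 0 < M)
    {π σ : Label N}
    (h : ∀ l ∈ Finset.Icc (par N) (rk N), eigenval q M π l = eigenval q M σ l) : π = σ := by
  refine Label.expo_injective hN.le fun l hl => ?_
  have h1 := h l hl
  rw [eigenval_eq, eigenval_eq] at h1
  have h2 := zpow_right_injective₀ hq hq1.ne (mul_left_cancel₀ (by positivity) h1)
  omega

theorem eq_zero_of_inner_joint (hq : 0 < q) (hq1 : q < 1) (hN : par N < rk N)
    (hΓ : Γ.IsIrreducible) {M : ℝ} (hM : 0 < M) (h : Γ.HasEigenstate M) {x : H}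
    (hx : ∀ π : Label N, ∀ u ∈ Γ.joint (eigenval q M π), ⟪x, (u : H)⟫_ℂ = 0) : x = 0 := by
  refine (dense_total hq hq1 hN hΓ hM h).eq_zero_of_inner_left ℂ ?_
  rintro _ ⟨v, hv, rfl⟩
  refine Submodule.iSup_induction _ (motive := fun v => ⟪x, Γ.dom.subtype v⟫_ℂ = 0) hv hx
    (by simp) fun v w h1 h2 => by rw [map_add, inner_add_right, h1, h2, add_zero]

theorem sector_isOrtho (hq : 0 < q) (hq1 : q < 1) (hN : par N < rk N) {M : ℝ} (hM : 0 < M)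
    {π σ : Label N} (hne : π ≠ σ) : Γ.sector M π ⟂ Γ.sector M σ := by
  obtain ⟨l, hl, hls⟩ : ∃ l ∈ Finset.Icc (par N) (rk N), eigenval q M π l ≠ eigenval q M σ l := by
    by_contra! h
    exact hne (eigenval_injective hq hq1 hN hM h)
  refine (Submodule.isOrtho_iff_le.mpr ?_).symm
  refine Submodule.topologicalClosure_minimal _ ?_ (Submodule.isClosed_orthogonal _)
  rintro _ ⟨u, hu, rfl⟩ x hx
  rw [domSector_eq hq hq1 hN hM] at hu
  refine inner_eq_zero_of_mem_observable hq hl (a := (eigenval q M π l : ℂ)) ?_ hu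
    (by exact_mod_cast hls)
  refine mem_observable_of_mem_closure (fun v hv => ?_) hx
  rw [domSector_eq hq hq1 hN hM] at hv
  exact hv l hl

theorem subtype_mem_sector (hq : 0 < q) (hq1 : q < 1) (hN : par N < rk N) {M : ℝ} (hM : 0 < M)
    {π : Label N} {u : Γ.dom} (hu : u ∈ Γ.joint (eigenval q M π)) : (u : H) ∈ Γ.sector M π := by
  rw [← domSector_eq hq hq1 hN hM] at hu
  exact Submodule.le_topologicalClosure _ (Submodule.mem_map_of_mem hu)

end HilbertRep

end QEuclid

/-! ### Assembly of the proposition -/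

open QEuclid QEuclid.HilbertRep in
theorem proposition8 {N : ℕ} (hN : 3 ≤ N) {q : ℝ} (hq0 : 0 < q) (hq1 : q < 1)
    {H : Type*} [NormedAddCommGroup H] [InnerProductSpace ℂ H] [CompleteSpace H]
    (Γ : QEuclid.HilbertRep q N H) (hΓ : Γ.IsIrreducible)
    {M : ℝ} (hM : 0 < M) (hψ : Γ.HasEigenstate M) :
    -- the Hilbert space is the orthogonal direct sum of the nonzero closed subspaces `H_π`
    IsHilbertSum ℂ (fun π : QEuclid.Label N => Γ.sector M π)
        (fun π => (Γ.sector M π).subtypeₗᵢ) ∧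
      (∀ π : QEuclid.Label N, Γ.domSector M π ≠ ⊥) ∧
      -- `Λ^{π_n} (p^n)^{π_{n-1}} ⋯ H_0` is the joint eigenspace in the domain
      (∀ (π : QEuclid.Label N) (v : Γ.dom), v ∈ Γ.domSector M π ↔
        ∀ l ∈ Finset.Icc (QEuclid.par N) (QEuclid.rk N),
          Γ.act (QEuclid.sqMom q N l) v = (QEuclid.eigenval q M π l : ℂ) • v) ∧
      -- `H_π` is the joint eigenspace of the closed observables
      (∀ (π : QEuclid.Label N) (x : H), x ∈ Γ.sector M π ↔
        ∀ l ∈ Finset.Icc (QEuclid.par N) (QEuclid.rk N),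
          (x, (QEuclid.eigenval q M π l : ℂ) • x) ∈ Γ.observable l) ∧
      -- the eigenvalues of each observable make up the lattice `M² q^{2ℤ}`
      (∀ l ∈ Finset.Icc (QEuclid.par N) (QEuclid.rk N), ∀ a : ℂ,
        (∃ x : H, x ≠ 0 ∧ (x, a • x) ∈ Γ.observable l) ↔
          ∃ r : ℤ, a = ((M ^ 2 * q ^ (2 * r) : ℝ) : ℂ)) := by
  have hn := par_lt_rk hN
  have hdom := fun π => domSector_eq (Γ := Γ) hq0 hq1 hn hM π
  have hsub : ∀ (π : Label N) (x : H), x ∈ Γ.sector M π → ∀ l ∈ Finset.Icc (par N) (rk N),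
      (x, (eigenval q M π l : ℂ) • x) ∈ Γ.observable l := fun π x hx l hl =>
    mem_observable_of_mem_closure (fun v hv => by rw [hdom] at hv; exact hv l hl) hx
  have hcomplete : ∀ π, CompleteSpace (Γ.sector M π) := fun π =>
    (Submodule.isClosed_topologicalClosure _).completeSpace_coe
  refine ⟨IsHilbertSum.mkInternal (F := fun π => Γ.sector M π) ?_ ?_,
    domSector_ne_bot hq0 hq1 hn hM hψ, fun π v => by rw [hdom]; rfl,
    fun π x => ⟨hsub π x, fun hx => ?_⟩, fun l hl a => ⟨?_, ?_⟩⟩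
  · intro π σ hne v w
    exact Submodule.isOrtho_iff_inner_eq.mp (sector_isOrtho hq0 hq1 hn hM hne) (v : H) v.2 (w : H) w.2
  · intro x _
    refine closure_mono ?_ (dense_total hq0 hq1 hn hΓ hM hψ x)
    change ((_ : Submodule ℂ H) : Set H) ⊆ ((⨆ π, Γ.sector M π : Submodule ℂ H) : Set H)
    rw [SetLike.coe_subset_coe, total, Submodule.map_iSup, iSup_le_iff]
    rintro π _ ⟨u, hu, rfl⟩
    exact Submodule.mem_iSup_of_mem π (subtype_mem_sector hq0 hq1 hn hM hu)
  -- The component z of x orthogonal to the sector of π is orthogonal to every joint eigenspace: for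
  -- another label σ, both x and y are orthogonal to it. Density gives z = 0.
  · obtain ⟨y, hy, z, hz, rfl⟩ := (Γ.sector M π).exists_add_mem_mem_orthogonal x
    suffices z = 0 by rwa [this, add_zero]
    refine eq_zero_of_inner_joint hq0 hq1 hn hΓ hM hψ fun σ u hu => ?_
    have hu' := subtype_mem_sector hq0 hq1 hn hM hu
    by_cases h : π = σ
    · subst h
      exact Submodule.inner_left_of_mem_orthogonal hu' hz
    · obtain ⟨l, hl, hls⟩ : ∃ l ∈ Finset.Icc (par N) (rk N),
          eigenval q M π l ≠ eigenval q M σ l := by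
        by_contra! h'
        exact h (eigenval_injective hq0 hq1 hn hM h')
      have h1 := inner_eq_zero_of_mem_observable hq0 hl (hx l hl) hu (by exact_mod_cast hls)
      have h2 := Submodule.isOrtho_iff_inner_eq.mp (sector_isOrtho hq0 hq1 hn hM h) y hy u hu'
      rwa [inner_add_left, h2, zero_add] at h1
  · rintro ⟨x, hx0, hx⟩
    by_contra! h
    refine hx0 (eq_zero_of_inner_joint hq0 hq1 hn hΓ hM hψ fun π u hu =>
      inner_eq_zero_of_mem_observable hq0 hl hx hu ?_)
    rw [eigenval_eq]
    exact h _
  · rintro ⟨r, rfl⟩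
    rw [Finset.mem_Icc] at hl
    -- Without momentum factors the exponent at l is n + 1 - l + π_n; the power of Λ is chosen to
    -- make it r.
    set π : Label N := (0, r - ((rk N : ℤ) + 1 - l))
    obtain ⟨v, hv, hv0⟩ := Submodule.exists_mem_ne_zero_of_ne_bot
      (domSector_ne_bot hq0 hq1 hn hM hψ π)
    have hr : π.expo l = r := by
      rw [Label.expo_eq π hl.1 hl.2]
      simp [π]
    rw [hdom] at hv
    refine ⟨v, by simpa using hv0, ?_⟩
    rw [← hr, ← eigenval_eq]
    exact hsub π v (subtype_mem_sector hq0 hq1 hn hM hv) l (Finset.mem_Icc.mpr hl)
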